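/- **Model.** There is a homogeneous good, usable as consumption or capital, and an asset in unit supply paying deterministic dividends $D_t\ge 0$ ($t=0,1,\dots$), which cannot be shorted. Agents are indexed by a probability space $(I,\lambda)$ (a unit mass of agents; typically a continuum such as $[0,1]$), uncertainty is described by a probability space $(\Omega,\Pr)$, and joint measurability on $I\times\Omega$ is with respect to a Fubini extension of the product (a probability space on $I\times\Omega$ whose $\sigma$-algebra contains the product $\sigma$-algebra and on which integrals can be computed by iterated integration in both orders). The productivity $z_{it}$ of agent $i$ takes values in $\{z_0,\dots,z_N\}$, $0=z_0<z_1<\dots<z_N$, starts at a given value $z_{i0}$, and follows a Markov chain (with respect to the agent's information, to which it is adapted) with transition matrix $\Pi=(\pi_{nn'})_{n,n'=0}^N$; the processes $z_i$ are (essentially pairwise) independent across agents. Agents start with $z_{i,-1}\in\{z_0,\dots,z_N\}$, capital $k_{i,-1}\ge0$ and asset holdings $x_{i,-1}\ge 0$, both $\lambda$-integrable, with $\int_I x_{i,-1}\,di=1$. Given deterministic prices $P_t$, a plan $(c_{it},k_{it},x_{it})_{t\ge0}$ of agent $i$ is feasible if it is adapted to the agent's information, nonnegative, and satisfies, almost surely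 and for all $t$, $$c_{it}+k_{it}+P_tx_{it}=z_{i,t-1}k_{i,t-1}+(P_t+D_t)x_{i,t-1}.$$ Utility is $\mathrm{E}_0\sum_{t=0}^\infty\beta^t\log c_{it}$ with $\beta\in(0,1)$, defined as the expected discounted sum of positive parts minus that of negative parts ($\log 0=-\infty$, and utility is $-\infty$ if the negative part is infinite). An *equilibrium* consists of deterministic prices $P_t\ge0$ and a jointly measurable allocation $(c_{it},k_{it},x_{it})$ such that for almost every agent the plan is feasible, has utility greater than $-\infty$, and maximizes utility among all feasible plans; and the asset market clears: $\int_I x_{it}\,di=1$ almost surely for every $t$. An equilibrium is *bubbly* if, for Arrow–Debreu prices $q_t>0$ with $q_0=1$ and $q_tP_t=q_{t+1}(P_{t+1}+D_{t+1})$ for all $t$, one has $P_0>\sum_{t=1}^\infty q_tD_t$. For a growth rate $G>0$ it is *asymptotically bubbly* if it is bubbly and $\liminf_{t\to\infty}P_t/G^t>0$. **Theorem.** Let $A=(\beta z_n\pi_{nn'})_{n,n'=0}^N$, with spectral radius $\rho(A)$. Suppose that $\Pi$ and its submatrix $\Pi_1=(\pi_{nn'})_{n,n'=1}^N$ are irreducible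 and that $$0<G_d:=\limsup_{t\to\infty}D_t^{1/t}<\rho(A)=:G.$$ Then every equilibrium is asymptotically bubbly (with growth rate $G$). -/

import Mathlib

open MeasureTheory ProbabilityTheory Filter
open scoped ENNReal

noncomputable section

namespace Bewley

/-! ### Asset pricing: Arrow-Debreu prices, fundamental value, bubbles -/

/-- `q t` is the date-0 price of the good delivered at time `t`: normalized to `q 0 = 1`, positive,
and satisfying the no-arbitrage condition for an asset with ex-dividend prices `price` and
dividends `D`. -/
structure IsArrowDebreuPrice (price D q : ℕ → ℝ) : Prop where
  zero : q 0 = 1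
  pos : ∀ t, 0 < q t
  noArbitrage : ∀ t, q t * price t = q (t + 1) * (price (t + 1) + D (t + 1))

/-- The fundamental value `V₀ = ∑_{t ≥ 1} q_t D_t`, a sum of nonnegative terms. -/
def fundamentalValue (D q : ℕ → ℝ) : ℝ≥0∞ :=
  ∑' t : ℕ, ENNReal.ofReal (q (t + 1) * D (t + 1))

/-- The asset price contains a bubble: `P₀ > V₀`. -/
def IsBubbly (price D : ℕ → ℝ) : Prop :=
  ∃ q : ℕ → ℝ, IsArrowDebreuPrice price D q ∧ fundamentalValue D q < ENNReal.ofReal (price 0)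

/-- Asymptotically bubbly, relative to the economic growth rate `G`: there is a bubble, and
`liminf P_t / G^t > 0` (taken in the extended reals, since `P_t / G^t` may be unbounded). -/
def IsAsymptoticallyBubbly (price D : ℕ → ℝ) (G : ℝ) : Prop :=
  IsBubbly price D ∧ 0 < liminf (fun t : ℕ => ((price t / G ^ t : ℝ) : EReal)) atTop

/-! ### Primitives -/

/-- Preferences, technology and dividends. Type `0` agents are savers (productivity zero), types
`1, …, N` are investors with increasing productivity. -/
structure Primitives (N : ℕ) where
  /-- discount factor -/
  β : ℝ
  β_pos : 0 < β
  β_lt_one : β < 1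
  /-- productivities `0 = z₀ < z₁ < … < z_N` -/
  z : Fin (N + 1) → ℝ
  z_zero : z 0 = 0
  z_strictMono : StrictMono z
  /-- transition probability matrix of the productivity types -/
  trans : Matrix (Fin (N + 1)) (Fin (N + 1)) ℝ
  trans_nonneg : ∀ n n', 0 ≤ trans n n'
  trans_sum : ∀ n, ∑ n', trans n n' = 1
  /-- dividends of the asset, which is in unit supply -/
  D : ℕ → ℝ
  D_nonneg : ∀ t, 0 ≤ D t

namespace Primitives

variable {N : ℕ} (E : Primitives N)

/-- The submatrix of transition probabilities among the investor types `1, …, N`. -/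
def investorTrans : Matrix (Fin N) (Fin N) ℝ :=
  E.trans.submatrix Fin.succ Fin.succ

/-- The nonnegative matrix `A = (β z_n π_{nn'})`. -/
def growthMatrix : Matrix (Fin (N + 1)) (Fin (N + 1)) ℝ :=
  Matrix.of fun n n' => E.β * E.z n * E.trans n n'

/-- `G = ρ(A)`, the largest modulus of the complex eigenvalues of `A`. -/
def growthRate : ℝ≥0∞ :=
  spectralRadius ℂ (E.growthMatrix.map (fun a : ℝ => (a : ℂ)))

/-- `G_d = limsup D_t^{1/t}`. -/
def dividendGrowthRate : ℝ≥0∞ :=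
  limsup (fun t : ℕ => ENNReal.ofReal (E.D t ^ (1 / (t : ℝ)))) atTop

end Primitives

/-! ### The continuum of agents -/

/-- A Fubini extension of the product of the agent space `(I, lam)` and the sample space `(Ω, Pr)`:
a probability space on `I × Ω` whose σ-algebra contains the product σ-algebra and on which the
Fubini property holds. It is the standard framework in which a continuum of independent random
variables can be aggregated. -/
structure FubiniExtension {I Ω : Type*} [MeasurableSpace I] [MeasurableSpace Ω]
    (lam : Measure I) (Pr : Measure Ω) where
  sig : MeasurableSpace (I × Ω)
  meas : @Measure (I × Ω) sig
  prob : IsProbabilityMeasure meas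
  prod_le : (Prod.instMeasurableSpace : MeasurableSpace (I × Ω)) ≤ sig
  integrable_right : ∀ f : I × Ω → ℝ, Integrable f meas →
    ∀ᵐ i ∂lam, Integrable (fun ω => f (i, ω)) Pr
  integrable_left : ∀ f : I × Ω → ℝ, Integrable f meas →
    ∀ᵐ ω ∂Pr, Integrable (fun i => f (i, ω)) lam
  integrable_integral_right : ∀ f : I × Ω → ℝ, Integrable f meas →
    Integrable (fun i => ∫ ω, f (i, ω) ∂Pr) lam
  integrable_integral_left : ∀ f : I × Ω → ℝ, Integrable f meas →
    Integrable (fun ω => ∫ i, f (i, ω) ∂lam) Pr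
  integral_eq_right : ∀ f : I × Ω → ℝ, Integrable f meas →
    ∫ p, f p ∂meas = ∫ i, ∫ ω, f (i, ω) ∂Pr ∂lam
  integral_eq_left : ∀ f : I × Ω → ℝ, Integrable f meas →
    ∫ p, f p ∂meas = ∫ ω, ∫ i, f (i, ω) ∂lam ∂Pr

/-- The population of agents: types evolving as Markov chains that are independent across agents,
the information of each agent, and the initial specification of productivity and endowments. -/
structure Population {N : ℕ} (E : Primitives N) {I Ω : Type*} [MeasurableSpace I]
    [mΩ : MeasurableSpace Ω] (lam : Measure I) (Pr : Measure Ω) where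
  ext : FubiniExtension lam Pr
  /-- `type t i ω` is the productivity type of agent `i` at time `t`, so `z_{it} = z (type t i ω)` -/
  type : ℕ → I → Ω → Fin (N + 1)
  type_measurable : ∀ t, Measurable[ext.sig] (fun p : I × Ω => type t p.1 p.2)
  /-- what agent `i` knows at each time; it includes the history of the own type -/
  info : I → Filtration ℕ mΩ
  type_adapted : ∀ i t, Measurable[info i t] (type t i)
  markov : ∀ i t n',
    Pr[({ω | type (t + 1) i ω = n'}.indicator (fun _ => (1 : ℝ))) | info i t]
      =ᵐ[Pr] fun ω => E.trans (type t i ω) n'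
  indep : ∀ᵐ i ∂lam, ∀ᵐ j ∂lam,
    IndepFun (fun ω => fun t => type t i ω) (fun ω => fun t => type t j ω) Pr
  /-- the given type at time `0` -/
  initType : I → Fin (N + 1)
  type_zero : ∀ i ω, type 0 i ω = initType i
  /-- the type at time `-1`, which determines the output of the initial capital -/
  prevType : I → Fin (N + 1)
  prevType_measurable : Measurable prevType
  /-- initial capital -/
  k₀ : I → ℝ
  k₀_nonneg : ∀ i, 0 ≤ k₀ i
  k₀_integrable : Integrable k₀ lam
  /-- initial asset holdings -/
  x₀ : I → ℝ
  x₀_nonneg : ∀ i, 0 ≤ x₀ i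
  x₀_integrable : Integrable x₀ lam
  x₀_integral : ∫ i, x₀ i ∂lam = 1

/-! ### Individual optimization -/

/-- Expected discounted log utility `E ∑ β^t log c_t`, an extended real number, with `log 0 = -∞`:
expectation of the positive part minus expectation of the negative part (and the value is `-∞`
if the latter is infinite). -/
def lifetimeUtility {Ω : Type*} [MeasurableSpace Ω] (Pr : Measure Ω) (β : ℝ)
    (c : ℕ → Ω → ℝ) : EReal :=
  ((∫⁻ ω, ∑' t : ℕ, ENNReal.ofReal (β ^ t) *
      (ENNReal.log (ENNReal.ofReal (c t ω))).toENNReal ∂Pr : ℝ≥0∞) : EReal) -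
  ((∫⁻ ω, ∑' t : ℕ, ENNReal.ofReal (β ^ t) *
      (-ENNReal.log (ENNReal.ofReal (c t ω))).toENNReal ∂Pr : ℝ≥0∞) : EReal)

namespace Population

variable {N : ℕ} {E : Primitives N} {I Ω : Type*} [MeasurableSpace I] [mΩ : MeasurableSpace Ω]
  {lam : Measure I} {Pr : Measure Ω} (pop : Population E lam Pr)

/-- Wealth `w_t = z_{t-1} k_{t-1} + (P_t + D_t) x_{t-1}` of agent `i` at the beginning of time `t`
under the investment plan `(k, x)`. -/
def wealth (price : ℕ → ℝ) (i : I) (k x : ℕ → Ω → ℝ) : ℕ → Ω → ℝ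
  | 0, _ => E.z (pop.prevType i) * pop.k₀ i + (price 0 + E.D 0) * pop.x₀ i
  | t + 1, ω => E.z (pop.type t i ω) * k t ω + (price (t + 1) + E.D (t + 1)) * x t ω

/-- Plans `(c, k, x)` of consumption, capital and asset holdings available to agent `i`: contingent
on the agent's information, nonnegative, and satisfying the budget constraint at all times. -/
structure IsFeasible (price : ℕ → ℝ) (i : I) (c k x : ℕ → Ω → ℝ) : Prop where
  c_adapted : ∀ t, Measurable[pop.info i t] (c t)
  k_adapted : ∀ t, Measurable[pop.info i t] (k t)
  x_adapted : ∀ t, Measurable[pop.info i t] (x t)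
  c_nonneg : ∀ t, ∀ᵐ ω ∂Pr, 0 ≤ c t ω
  k_nonneg : ∀ t, ∀ᵐ ω ∂Pr, 0 ≤ k t ω
  x_nonneg : ∀ t, ∀ᵐ ω ∂Pr, 0 ≤ x t ω
  budget : ∀ t, ∀ᵐ ω ∂Pr, c t ω + k t ω + price t * x t ω = pop.wealth price i k x t ω

/-- The plan maximizes lifetime utility among the feasible plans of agent `i`. The maximum is
required to exceed `-∞`: otherwise every feasible plan would be a maximizer. -/
structure IsOptimal (price : ℕ → ℝ) (i : I) (c k x : ℕ → Ω → ℝ) : Prop where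
  feasible : pop.IsFeasible price i c k x
  utility_ne_bot : lifetimeUtility Pr E.β c ≠ ⊥
  maximal : ∀ c' k' x' : ℕ → Ω → ℝ, pop.IsFeasible price i c' k' x' →
    lifetimeUtility Pr E.β c' ≤ lifetimeUtility Pr E.β c

/-- Rational expectations equilibrium: asset prices and an allocation, such that (almost) every
agent optimizes and the asset market clears at all times. -/
structure IsEquilibrium (price : ℕ → ℝ) (c k x : ℕ → I → Ω → ℝ) : Prop where
  price_nonneg : ∀ t, 0 ≤ price t
  c_measurable : ∀ t, Measurable[pop.ext.sig] (fun p : I × Ω => c t p.1 p.2)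
  k_measurable : ∀ t, Measurable[pop.ext.sig] (fun p : I × Ω => k t p.1 p.2)
  x_measurable : ∀ t, Measurable[pop.ext.sig] (fun p : I × Ω => x t p.1 p.2)
  optimal : ∀ᵐ i ∂lam, pop.IsOptimal price i (fun t => c t i) (fun t => k t i) (fun t => x t i)
  clearing : ∀ t, ∀ᵐ ω ∂Pr, ∫ i, x t i ω ∂lam = 1

end Population

end Bewley

end

/-! With logarithmic utility and returns proportional to investment, an agent of type `n` consumes
the fraction `1 - β` of wealth and puts the rest where the return is higher, earning `max z_n R_t`
with `R_t = (P_{t+1} + D_{t+1}) / P_t` (`IsOptimal.wealth_eq`). The aggregate wealth `W_t(n)` of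
type `n` therefore satisfies `W_{t+1}(n') = ∑ π_{nn'} β max(z_n, R_t) W_t(n)`, which dominates `W_t
A` entrywise. A nonnegative vector `v ≠ 0` with `G v ≤ A v` (`exists_subinvariant_of_nonneg`) turns
this into growth: `W_t · v` grows at least by the factor `G` each period.

The price keeps up with wealth (`exists_mul_typeWealth_le_price`). Savers of type `0` always put all
their savings into the asset, so `β W_t(0) ≤ P_t`. For another type `n`, either `R_t > z_N` and
everybody saves in the asset, or `z_N P_t ≥ P_{t+1} + D_{t+1}`, and tomorrow's price bounds the
wealth that type `n` passes to the next type on a path to `0`. Hence `P_t ≥ κ G^t` eventually. Since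
`D_t ≤ M g^t` with `g < G`, dividend yields are summable, and Montrucchio's criterion
`isBubbly_of_summable` gives the bubble.

Two points need preparation. The optimality argument requires the positive part of utility to be
finite; aggregate resources grow at most exponentially, so this holds for almost every agent
(`ae_expectedSum_logGain_ne_top`). Prices must be positive: a free asset would have zero payoffs
forever, while dividends are positive infinitely often (`price_pos`). -/

namespace Bewley

/-! ### Arrow-Debreu prices and summable dividend yields. -/

/-- Montrucchio's criterion: a positive asset price contains a bubble if dividend yields are
summable. -/
theorem isBubbly_of_summable {price D : ℕ → ℝ} (hP : ∀ t, 0 < price t) (hD : ∀ t, 0 ≤ D t)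
    (hs : Summable fun t => D t / price t) : IsBubbly price D := by
  set d : ℕ → ℝ := fun s => D (s + 1) / price (s + 1) with hd
  have hd0 : ∀ s, 0 ≤ d s := fun s => div_nonneg (hD _) (hP _).le
  set Q : ℕ → ℝ := fun t => ∏ s ∈ Finset.range t, (1 + d s) with hQ
  have hQpos : ∀ t, 0 < Q t := fun t => Finset.prod_pos fun s _ => by linarith [hd0 s]
  have hds : Summable d := (summable_nat_add_iff 1).2 hs
  have hQle : ∀ t, Q t ≤ Real.exp (∑' s, d s) := by
    intro t
    calc Q t ≤ ∏ s ∈ Finset.range t, Real.exp (d s) :=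
          Finset.prod_le_prod (fun s _ => by linarith [hd0 s])
            (fun s _ => by linarith [Real.add_one_le_exp (d s)])
      _ = Real.exp (∑ s ∈ Finset.range t, d s) := (Real.exp_sum _ _).symm
      _ ≤ _ := Real.exp_le_exp.2 (hds.sum_le_tsum _ fun s _ => hd0 s)
  have hstep : ∀ t, Q (t + 1) * price (t + 1) = Q t * (price (t + 1) + D (t + 1)) := by
    intro t
    have := (hP (t + 1)).ne'
    simp only [hQ, Finset.prod_range_succ, hd]
    field_simp
  -- Chosen so that `q t * price t = price 0 / Q t`; the no-arbitrage condition is then the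
  -- recursion `hstep`.
  set q : ℕ → ℝ := fun t => price 0 / (Q t * price t) with hq
  have hqpos : ∀ t, 0 < q t := fun t => div_pos (hP 0) (mul_pos (hQpos t) (hP t))
  have hqP : ∀ t, q t * price t = price 0 / Q t := fun t => by
    have := (hP t).ne'
    have := (hQpos t).ne'
    simp only [hq]; field_simp
  have hAD : IsArrowDebreuPrice price D q := by
    refine ⟨?_, hqpos, fun t => ?_⟩
    · have := (hP 0).ne'
      simp [hq, hQ, this]
    · have h1 := (hQpos t).ne'
      have h2 : price (t + 1) + D (t + 1) ≠ 0 := by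
        have := hP (t + 1); have := hD (t + 1); positivity
      rw [hqP]
      simp only [hq, hstep]
      field_simp
  refine ⟨q, hAD, ?_⟩
  -- A lower bound for all `q n * price n`, the part of `price 0` not covered by dividends up to
  -- date `n`.
  set ε := price 0 / Real.exp (∑' s, d s) with hε
  have hεpos : 0 < ε := div_pos (hP 0) (Real.exp_pos _)
  have hbound : fundamentalValue D q ≤ ENNReal.ofReal (price 0 - ε) := by
    refine ENNReal.tsum_le_of_sum_range_le fun n => ?_
    rw [← ENNReal.ofReal_sum_of_nonneg fun t _ => mul_nonneg (hqpos _).le (hD _)]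
    refine ENNReal.ofReal_le_ofReal ?_
    have hsum : ∑ t ∈ Finset.range n, q (t + 1) * D (t + 1) = price 0 - q n * price n := by
      have : ∀ t, q (t + 1) * D (t + 1) = q t * price t - q (t + 1) * price (t + 1) := fun t => by
        rw [hAD.noArbitrage t]; ring
      simp only [this, Finset.sum_range_sub', hAD.zero, one_mul]
    rw [hsum, hqP]
    have : ε ≤ price 0 / Q n := div_le_div_of_nonneg_left (hP 0).le (hQpos n) (hQle n)
    linarith
  exact hbound.trans_lt ((ENNReal.ofReal_lt_ofReal_iff (hP 0)).2 (by linarith))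

/-! ### A Perron-Frobenius inequality. -/

/-- The moduli of the entries of a complex eigenvector of a nonnegative matrix, for an eigenvalue
of maximal modulus, form a subinvariant vector. -/
theorem exists_subinvariant_of_nonneg {n : Type*} [Fintype n] [DecidableEq n]
    (A : Matrix n n ℝ) (hA : ∀ i j, 0 ≤ A i j)
    (hr : 0 < spectralRadius ℂ (A.map fun a : ℝ => (a : ℂ))) :
    spectralRadius ℂ (A.map fun a : ℝ => (a : ℂ)) ≠ ⊤ ∧
    ∃ v : n → ℝ, (∀ i, 0 ≤ v i) ∧ (∃ i, 0 < v i) ∧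
      ∀ i, (spectralRadius ℂ (A.map fun a : ℝ => (a : ℂ))).toReal * v i ≤ ∑ j, A i j * v j := by
  set B := A.map fun a : ℝ => (a : ℂ) with hB
  have hfin : (spectrum ℂ B).Finite := Matrix.finite_spectrum B
  -- The index type may be empty; a positive radius excludes an empty spectrum, and finiteness makes
  -- the maximal modulus attained.
  have hne : (spectrum ℂ B).Nonempty := by
    by_contra h
    rw [Set.not_nonempty_iff_eq_empty] at h
    simp [spectralRadius, h] at hr
  obtain ⟨l, hl, hmax⟩ := hfin.exists_maximalFor (fun k => ‖k‖₊) _ hne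
  have hmax' : ∀ k ∈ spectrum ℂ B, ‖k‖₊ ≤ ‖l‖₊ := fun k hk => by
    rcases le_total ‖k‖₊ ‖l‖₊ with h | h
    · exact h
    · exact hmax hk h
  have hrad : spectralRadius ℂ B = (‖l‖₊ : ℝ≥0∞) :=
    le_antisymm (iSup₂_le fun k hk => by exact_mod_cast hmax' k hk)
      (le_iSup₂ (f := fun k (_ : k ∈ spectrum ℂ B) => (‖k‖₊ : ℝ≥0∞)) l hl)
  rw [hrad]
  refine ⟨ENNReal.coe_ne_top, ?_⟩
  rw [← Matrix.spectrum_toLin', ← Module.End.hasEigenvalue_iff_mem_spectrum] at hl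
  obtain ⟨u, hu⟩ := hl.exists_hasEigenvector
  refine ⟨fun i => ‖u i‖, fun i => norm_nonneg _, ?_, fun i => ?_⟩
  · obtain ⟨i, hi⟩ := Function.ne_iff.1 hu.2
    exact ⟨i, norm_pos_iff.2 hi⟩
  · have h := congrFun hu.apply_eq_smul i
    simp only [Matrix.toLin'_apply, Matrix.mulVec, dotProduct, Pi.smul_apply, smul_eq_mul] at h
    calc (‖l‖₊ : ℝ≥0∞).toReal * ‖u i‖ = ‖l * u i‖ := by simp
      _ = ‖∑ j, B i j * u j‖ := by rw [h]
      _ ≤ ∑ j, ‖B i j * u j‖ := norm_sum_le _ _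
      _ = ∑ j, A i j * ‖u j‖ := Finset.sum_congr rfl fun j _ => by
          simp [hB, abs_of_nonneg (hA i j)]

/-! ### Consequences of the dividend growth rate. -/

namespace Primitives

variable {N : ℕ} (E : Primitives N)

theorem frequently_dividend_pos (hpos : 0 < E.dividendGrowthRate) : ∃ᶠ t in atTop, 0 < E.D t := by
  intro h
  have : E.dividendGrowthRate = 0 := by
    have he : (fun t : ℕ => ENNReal.ofReal (E.D t ^ (1 / (t : ℝ)))) =ᶠ[atTop] fun _ => 0 := by
      -- At `t = 0` the exponent `1 / t` is `0`, and `0 ^ 0 = 1`.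
      filter_upwards [h, eventually_gt_atTop 0] with t ht ht0
      have h0 : E.D t = 0 := le_antisymm (not_lt.1 ht) (E.D_nonneg t)
      have h1 : (1 / (t : ℝ)) ≠ 0 := by positivity
      rw [h0, Real.zero_rpow h1, ENNReal.ofReal_zero]
    rw [dividendGrowthRate, limsup_congr he]
    simp
  exact hpos.ne' this

theorem exists_dividend_le {G : ℝ} (hG : E.dividendGrowthRate < ENNReal.ofReal G) :
    ∃ g M : ℝ, 0 < g ∧ g < G ∧ 0 < M ∧ ∀ t, E.D t ≤ M * g ^ t := by
  obtain ⟨r, hr1, hr2⟩ := exists_between hG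
  have hrtop : r ≠ ⊤ := (hr2.trans_le le_top).ne
  set g := r.toReal with hg
  have hg0 : 0 < g := ENNReal.toReal_pos (zero_le.trans_lt hr1).ne' hrtop
  have hev : ∀ᶠ t in atTop, E.D t ≤ g ^ t := by
    filter_upwards [eventually_lt_of_limsup_lt hr1, eventually_gt_atTop 0] with t ht ht0
    have h1 : E.D t ^ (1 / (t : ℝ)) ≤ g := by
      rw [← ENNReal.ofReal_toReal hrtop] at ht
      exact ((ENNReal.ofReal_lt_ofReal_iff hg0).1 ht).le
    have h2 : (E.D t ^ (1 / (t : ℝ))) ^ t ≤ g ^ t :=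
      pow_le_pow_left₀ (Real.rpow_nonneg (E.D_nonneg t) _) h1 t
    rwa [one_div, Real.rpow_inv_natCast_pow (E.D_nonneg t) ht0.ne'] at h2
  obtain ⟨T, hT⟩ := eventually_atTop.1 hev
  -- The sum absorbs the finitely many dates before `T`; the `1` serves all later ones.
  refine ⟨g, 1 + ∑ s ∈ Finset.range T, E.D s / g ^ s, hg0, ?_, ?_, fun t => ?_⟩
  · rw [hg]
    have hGpos : 0 < G := ENNReal.ofReal_pos.1 (zero_le.trans_lt hr2)
    exact (ENNReal.toReal_lt_toReal hrtop ENNReal.ofReal_ne_top).2 hr2 |>.trans_eq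
      (ENNReal.toReal_ofReal hGpos.le)
  · have : 0 ≤ ∑ s ∈ Finset.range T, E.D s / g ^ s :=
      Finset.sum_nonneg fun s _ => div_nonneg (E.D_nonneg s) (by positivity)
    linarith
  · have hterm : ∀ s ∈ Finset.range T, 0 ≤ E.D s / g ^ s :=
      fun s _ => div_nonneg (E.D_nonneg s) (by positivity)
    rcases lt_or_ge t T with h | h
    · have h1 := Finset.single_le_sum hterm (Finset.mem_range.2 h)
      have h2 : E.D t = E.D t / g ^ t * g ^ t := by field_simp
      rw [h2]
      gcongr
      linarith
    · have := Finset.sum_nonneg hterm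
      have h3 : 0 < g ^ t := by positivity
      nlinarith [hT t h]

end Primitives

/-! ### Almost-everywhere statements and integrability on a Fubini extension. -/

namespace FubiniExtension

variable {I Ω : Type*} [MeasurableSpace I] [MeasurableSpace Ω] {lam : Measure I} {Pr : Measure Ω}
  (F : FubiniExtension lam Pr)

/-- The indicator of the exceptional set is a.e. zero, hence integrable without measurability of
`Q`, and its iterated integral vanishes. -/
theorem ae_ae_right {Q : I × Ω → Prop} (h : ∀ᵐ p ∂F.meas, Q p) :
    ∀ᵐ i ∂lam, ∀ᵐ ω ∂Pr, Q (i, ω) := by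
  classical
  set f : I × Ω → ℝ := fun p => if Q p then 0 else 1 with hf
  have hf0 : ∀ p, 0 ≤ f p := fun p => by simp only [hf]; split_ifs <;> simp
  have hfz : f =ᵐ[F.meas] fun _ => 0 := by
    filter_upwards [h] with p hp
    simp [hf, hp]
  have hint : Integrable f F.meas := (integrable_zero _ _ _).congr hfz.symm
  have h0 : ∫ i, ∫ ω, f (i, ω) ∂Pr ∂lam = 0 := by
    rw [← F.integral_eq_right f hint, integral_congr_ae hfz, integral_zero]
  rw [integral_eq_zero_iff_of_nonneg (fun i => integral_nonneg fun ω => hf0 _)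
    (F.integrable_integral_right f hint)] at h0
  filter_upwards [h0, F.integrable_right f hint] with i hi hi'
  rw [Pi.zero_apply, integral_eq_zero_iff_of_nonneg (fun ω => hf0 _) hi'] at hi
  filter_upwards [hi] with ω hω
  by_contra hQ
  simp [hf, hQ] at hω

theorem ae_of_ae_ae_right {Q : I × Ω → Prop} (hQ : @NullMeasurableSet _ F.sig {p | Q p} F.meas)
    (h : ∀ᵐ i ∂lam, ∀ᵐ ω ∂Pr, Q (i, ω)) : ∀ᵐ p ∂F.meas, Q p := by
  have := F.prob
  set f : I × Ω → ℝ := {p | Q p}ᶜ.indicator fun _ => 1 with hf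
  have hf0 : ∀ p, 0 ≤ f p := fun p => Set.indicator_nonneg (fun _ _ => zero_le_one) p
  have hint : Integrable f F.meas := (integrable_const (1 : ℝ)).indicator₀ hQ.compl
  have h0 : ∫ p, f p ∂F.meas = 0 := by
    rw [F.integral_eq_right f hint]
    have : (fun i => ∫ ω, f (i, ω) ∂Pr) =ᵐ[lam] fun _ => 0 := by
      filter_upwards [h] with i hi
      refine integral_eq_zero_of_ae ?_
      filter_upwards [hi] with ω hω
      simp [hf, hω]
    rw [integral_congr_ae this, integral_zero]
  rw [integral_eq_zero_iff_of_nonneg hf0 hint] at h0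
  filter_upwards [h0] with p hp
  by_contra hQp
  simp [hf, hQp] at hp

theorem measurable_fst : Measurable[F.sig] (Prod.fst : I × Ω → I) :=
  fun _ hs => F.prod_le _ (_root_.measurable_fst hs)

/-- The Fubini property for the indicator of `s × Ω`; it carries integrability of the initial
endowments from `I` to `I × Ω`. -/
theorem measurePreserving_fst [IsProbabilityMeasure lam] [IsProbabilityMeasure Pr] :
    @MeasurePreserving _ _ F.sig _ (Prod.fst : I × Ω → I) F.meas lam := by
  have := F.prob
  refine @MeasurePreserving.mk _ _ F.sig _ _ _ _ F.measurable_fst ?_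
  ext s hs
  have hs' : MeasurableSet[F.sig] (Prod.fst ⁻¹' s : Set (I × Ω)) := F.measurable_fst hs
  rw [Measure.map_apply F.measurable_fst hs]
  have h1 : Integrable ((Prod.fst ⁻¹' s : Set (I × Ω)).indicator fun _ => (1 : ℝ)) F.meas :=
    (integrable_const (1 : ℝ)).indicator hs'
  have h2 := F.integral_eq_right _ h1
  have h3 : ∀ i : I, ∫ ω, (Prod.fst ⁻¹' s : Set (I × Ω)).indicator (fun _ => (1 : ℝ)) (i, ω) ∂Pr
      = s.indicator (fun _ => 1) i := by
    intro i
    by_cases hi : i ∈ s <;> simp [hi]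
  simp only [h3] at h2
  rw [integral_indicator_const _ hs', integral_indicator_const _ hs] at h2
  simp only [smul_eq_mul, mul_one, Measure.real] at h2
  exact (ENNReal.toReal_eq_toReal_iff' (measure_ne_top _ _) (measure_ne_top _ _)).1 h2

/-- A nonnegative function with unit aggregate in almost all states is integrable. -/
theorem integrable_of_integral_left_eq_one [IsProbabilityMeasure Pr] {f : I × Ω → ℝ}
    (hf : Measurable[F.sig] f) (hf0 : ∀ᵐ p ∂F.meas, 0 ≤ f p)
    (h : ∀ᵐ ω ∂Pr, ∫ i, f (i, ω) ∂lam = 1) : Integrable f F.meas := by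
  have := F.prob
  -- The Fubini property covers only integrable functions, so it is applied to the truncations `min
  -- f M`; Fatou's lemma then passes to `f`.
  set g : ℕ → I × Ω → ℝ := fun M p => min (f p) M with hg
  have hgm : ∀ M, Measurable[F.sig] (g M) := fun M =>
    hf.min measurable_const
  have hg0 : ∀ M, ∀ᵐ p ∂F.meas, 0 ≤ g M p := fun M => by
    filter_upwards [hf0] with p hp using le_min hp (Nat.cast_nonneg _)
  have hgi : ∀ M, Integrable (g M) F.meas := fun M => by
    refine Integrable.of_bound (hgm M).aestronglyMeasurable M ?_
    filter_upwards [hg0 M] with p hp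
    rw [Real.norm_of_nonneg hp]
    exact min_le_right _ _
  have hle : ∀ M, ∫⁻ p, ENNReal.ofReal (g M p) ∂F.meas ≤ 1 := fun M => by
    rw [← ofReal_integral_eq_lintegral_ofReal (hgi M) (hg0 M), ENNReal.ofReal_le_one,
      F.integral_eq_left _ (hgi M)]
    calc ∫ ω, ∫ i, g M (i, ω) ∂lam ∂Pr ≤ ∫ ω, (1 : ℝ) ∂Pr := by
          refine integral_mono_ae (F.integrable_integral_left _ (hgi M)) (integrable_const _) ?_
          filter_upwards [h, F.integrable_left _ (hgi M)] with ω hω hi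
          -- A non-integrable slice would have Bochner integral `0`, not `1`.
          have hfi : Integrable (fun i => f (i, ω)) lam := by
            by_contra hni
            rw [integral_undef hni] at hω
            exact zero_ne_one hω
          rw [← hω]
          exact integral_mono hi hfi fun i => min_le_left _ _
      _ = 1 := by simp
  refine ⟨hf.aestronglyMeasurable, ?_⟩
  rw [hasFiniteIntegral_iff_ofReal hf0]
  have hsup : ∀ p, ENNReal.ofReal (f p) = liminf (fun M => ENNReal.ofReal (g M p)) atTop := by
    intro p
    refine (Tendsto.liminf_eq ?_).symm
    refine tendsto_const_nhds.congr' ?_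
    obtain ⟨M, hM⟩ := exists_nat_ge (f p)
    filter_upwards [eventually_ge_atTop M] with M' hM'
    simp only [hg]
    rw [min_eq_left (hM.trans (by exact_mod_cast hM'))]
  calc ∫⁻ p, ENNReal.ofReal (f p) ∂F.meas
      = ∫⁻ p, liminf (fun M => ENNReal.ofReal (g M p)) atTop ∂F.meas := by simp only [hsup]
    _ ≤ liminf (fun M => ∫⁻ p, ENNReal.ofReal (g M p) ∂F.meas) atTop :=
        lintegral_liminf_le fun M => (hgm M).ennreal_ofReal
    _ ≤ liminf (fun _ : ℕ => (1 : ℝ≥0∞)) atTop := liminf_le_liminf (Eventually.of_forall hle)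
    _ = 1 := by simp
    _ < ⊤ := ENNReal.one_lt_top

/-- A function with values in `[0, ∞]` and finite integral has finite expectation for almost every
agent. -/
theorem ae_lintegral_right_ne_top {f : I × Ω → ℝ≥0∞} (hf : Measurable[F.sig] f)
    (h : ∫⁻ p, f p ∂F.meas ≠ ⊤) : ∀ᵐ i ∂lam, ∫⁻ ω, f (i, ω) ∂Pr ≠ ⊤ := by
  have hint : Integrable (fun p => (f p).toReal) F.meas :=
    integrable_toReal_of_lintegral_ne_top hf.aemeasurable h
  filter_upwards [F.integrable_right _ hint, F.ae_ae_right (ae_lt_top hf h)] with i hi hi'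
  have := (hasFiniteIntegral_iff_ofReal (ae_of_all _ fun ω => ENNReal.toReal_nonneg)).1 hi.2
  refine (lt_of_eq_of_lt (lintegral_congr_ae ?_) this).ne
  filter_upwards [hi'] with ω hω
  exact (ENNReal.ofReal_toReal hω.ne).symm

end FubiniExtension

/-! ### Extended-valued logarithmic utility. -/

/-- Moves utility comparisons from differences in `EReal` to sums in `ℝ≥0∞`. The gain `a` of the
competing plan may be infinite a priori; the inequality itself excludes that. -/
theorem add_le_add_of_coe_sub_le {a b c d : ℝ≥0∞} (hb : b ≠ ⊤) (hc : c ≠ ⊤) (hd : d ≠ ⊤)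
    (h : (a : EReal) - b ≤ (c : EReal) - d) : a + d ≤ c + b := by
  lift b to NNReal using hb
  lift c to NNReal using hc
  lift d to NNReal using hd
  induction a with
  | top =>
    exfalso
    have h1 : ((b : ℝ≥0∞) : EReal) = ((b : ℝ) : EReal) := rfl
    have h2 : ((c : ℝ≥0∞) : EReal) = ((c : ℝ) : EReal) := rfl
    have h3 : ((d : ℝ≥0∞) : EReal) = ((d : ℝ) : EReal) := rfl
    rw [h1, h2, h3, EReal.coe_ennreal_top, EReal.top_sub_coe, ← EReal.coe_sub, top_le_iff] at h
    exact EReal.coe_ne_top _ h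
  | coe a =>
    have h0 : ((a : ℝ≥0∞) : EReal) = ((a : ℝ) : EReal) := rfl
    have h1 : ((b : ℝ≥0∞) : EReal) = ((b : ℝ) : EReal) := rfl
    have h2 : ((c : ℝ≥0∞) : EReal) = ((c : ℝ) : EReal) := rfl
    have h3 : ((d : ℝ≥0∞) : EReal) = ((d : ℝ) : EReal) := rfl
    rw [h0, h1, h2, h3, ← EReal.coe_sub, ← EReal.coe_sub, EReal.coe_le_coe_iff] at h
    have : (a : ℝ) + d ≤ c + b := by linarith
    exact_mod_cast this

/-- Positive part of `log x`, with values in `[0, ∞]`. -/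
noncomputable def logGain (x : ℝ) : ℝ≥0∞ := (ENNReal.log (ENNReal.ofReal x)).toENNReal

/-- Negative part of `log x`, with values in `[0, ∞]`. -/
noncomputable def logLoss (x : ℝ) : ℝ≥0∞ := (-ENNReal.log (ENNReal.ofReal x)).toENNReal

theorem logGain_of_pos {x : ℝ} (hx : 0 < x) : logGain x = ENNReal.ofReal (Real.log x) := by
  rw [logGain, ENNReal.log_ofReal_of_pos hx, EReal.toENNReal_of_ne_top (EReal.coe_ne_top _),
    EReal.toReal_coe]

theorem logLoss_of_pos {x : ℝ} (hx : 0 < x) : logLoss x = ENNReal.ofReal (-Real.log x) := by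
  rw [logLoss, ENNReal.log_ofReal_of_pos hx, ← EReal.coe_neg,
    EReal.toENNReal_of_ne_top (EReal.coe_ne_top _), EReal.toReal_coe]

theorem logGain_of_nonpos {x : ℝ} (hx : x ≤ 0) : logGain x = 0 := by
  simp [logGain, ENNReal.ofReal_of_nonpos hx]

theorem logLoss_of_nonpos {x : ℝ} (hx : x ≤ 0) : logLoss x = ⊤ := by
  simp [logLoss, ENNReal.ofReal_of_nonpos hx]

theorem logGain_mono : Monotone logGain := fun _ _ h =>
  EReal.toENNReal_le_toENNReal (ENNReal.log_monotone (ENNReal.ofReal_le_ofReal h))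

theorem logLoss_anti : Antitone logLoss := fun _ _ h =>
  EReal.toENNReal_le_toENNReal
    (EReal.neg_le_neg_iff.2 (ENNReal.log_monotone (ENNReal.ofReal_le_ofReal h)))

@[fun_prop]
theorem measurable_logGain : Measurable logGain := logGain_mono.measurable

@[fun_prop]
theorem measurable_logLoss : Measurable logLoss := logLoss_anti.measurable

theorem eq_of_logGain_eq_of_logLoss_eq {x y : ℝ} (hx : 0 < x) (hxy : x ≤ y)
    (h1 : logGain x = logGain y) (h2 : logLoss x = logLoss y) : x = y := by
  have hy := hx.trans_le hxy
  rw [logGain_of_pos hx, logGain_of_pos hy] at h1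
  rw [logLoss_of_pos hx, logLoss_of_pos hy] at h2
  by_contra hne
  have hlt : Real.log x < Real.log y := Real.log_lt_log hx (lt_of_le_of_ne hxy hne)
  rcases le_or_gt (Real.log y) 0 with h | h
  · have := (ENNReal.ofReal_lt_ofReal_iff (by linarith : (0 : ℝ) < -Real.log x)).2
      (by linarith : -Real.log y < -Real.log x)
    exact this.ne h2.symm
  · exact ((ENNReal.ofReal_lt_ofReal_iff h).2 hlt).ne h1

section

variable {Ω : Type*} {mΩ : MeasurableSpace Ω} {Pr : Measure Ω} {β : ℝ}

/-- Expected discounted sum of a process with values in `[0, ∞]`. -/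
noncomputable def expectedSum (Pr : Measure Ω) (β : ℝ) (f : ℕ → Ω → ℝ≥0∞) : ℝ≥0∞ :=
  ∫⁻ ω, ∑' t : ℕ, ENNReal.ofReal (β ^ t) * f t ω ∂Pr

theorem lifetimeUtility_eq (c : ℕ → Ω → ℝ) :
    lifetimeUtility Pr β c = (expectedSum Pr β fun t ω => logGain (c t ω) : EReal) -
      (expectedSum Pr β fun t ω => logLoss (c t ω) : EReal) := rfl

theorem measurable_discountedSum {f : ℕ → Ω → ℝ≥0∞} (hf : ∀ t, Measurable (f t)) :
    Measurable fun ω => ∑' t : ℕ, ENNReal.ofReal (β ^ t) * f t ω :=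
  Measurable.tsum fun t => (hf t).const_mul _

theorem expectedSum_add {f g : ℕ → Ω → ℝ≥0∞} (hf : ∀ t, Measurable (f t)) :
    expectedSum Pr β (fun t ω => f t ω + g t ω) = expectedSum Pr β f + expectedSum Pr β g := by
  simp only [expectedSum, mul_add, ENNReal.tsum_add]
  exact lintegral_add_left (measurable_discountedSum hf) _

theorem expectedSum_mono {f g : ℕ → Ω → ℝ≥0∞} (h : ∀ t, ∀ᵐ ω ∂Pr, f t ω ≤ g t ω) :
    expectedSum Pr β f ≤ expectedSum Pr β g := by
  refine lintegral_mono_ae ?_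
  filter_upwards [ae_all_iff.2 h] with ω hω
  exact ENNReal.tsum_le_tsum fun t => by gcongr; exact hω t

theorem ae_lt_top_of_expectedSum (hβ : 0 < β) {f : ℕ → Ω → ℝ≥0∞} (hf : ∀ t, Measurable (f t))
    (h : expectedSum Pr β f ≠ ⊤) (t : ℕ) : ∀ᵐ ω ∂Pr, f t ω < ⊤ := by
  filter_upwards [ae_lt_top (measurable_discountedSum hf) h] with ω hω
  have h1 := (ENNReal.le_tsum t).trans_lt hω
  by_contra h2
  rw [not_lt_top_iff.1 h2, ENNReal.mul_top (ENNReal.ofReal_pos.2 (pow_pos hβ t)).ne'] at h1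
  exact h1.ne rfl

theorem ae_eq_of_expectedSum_le (hβ : 0 < β) {f g : ℕ → Ω → ℝ≥0∞} (hg : ∀ t, Measurable (g t))
    (hfg : ∀ t, ∀ᵐ ω ∂Pr, f t ω ≤ g t ω) (hfin : expectedSum Pr β f ≠ ⊤)
    (h : expectedSum Pr β g ≤ expectedSum Pr β f) (t : ℕ) : ∀ᵐ ω ∂Pr, f t ω = g t ω := by
  have hle : ∀ᵐ ω ∂Pr, ∀ t, f t ω ≤ g t ω := ae_all_iff.2 hfg
  have heq := ae_eq_of_ae_le_of_lintegral_le
    (f := fun ω => ∑' t : ℕ, ENNReal.ofReal (β ^ t) * f t ω)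
    (g := fun ω => ∑' t : ℕ, ENNReal.ofReal (β ^ t) * g t ω) (μ := Pr)
    (by filter_upwards [hle] with ω hω
        exact ENNReal.tsum_le_tsum fun t => by gcongr; exact hω t)
    hfin (measurable_discountedSum hg).aemeasurable h
  filter_upwards [hle, heq, ae_lt_top (measurable_discountedSum hg) (h.trans_lt
    (lt_top_iff_ne_top.2 hfin)).ne] with ω h1 h2 h3
  by_contra hne
  have hlt : f t ω < g t ω := lt_of_le_of_ne (h1 t) hne
  have h4 : ENNReal.ofReal (β ^ t) * f t ω < ENNReal.ofReal (β ^ t) * g t ω :=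
    (ENNReal.mul_lt_mul_iff_right (ENNReal.ofReal_pos.2 (pow_pos hβ t)).ne'
      ENNReal.ofReal_ne_top).2 hlt
  have h5 := ENNReal.tsum_lt_tsum (f := fun t => ENNReal.ofReal (β ^ t) * f t ω)
    (g := fun t => ENNReal.ofReal (β ^ t) * g t ω)
    (by simpa only [h2] using h3.ne) (fun t => by gcongr; exact h1 t) h4
  exact h5.ne h2

theorem expectedSum_logLoss_ne_top {c : ℕ → Ω → ℝ} (h : lifetimeUtility Pr β c ≠ ⊥) :
    expectedSum Pr β (fun t ω => logLoss (c t ω)) ≠ ⊤ := by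
  intro htop
  apply h
  rw [lifetimeUtility_eq, htop, EReal.coe_ennreal_top, sub_eq_add_neg, EReal.neg_top,
    EReal.add_bot]

theorem ae_pos_of_expectedSum_logLoss (hβ : 0 < β) {c : ℕ → Ω → ℝ} (hc : ∀ t, Measurable (c t))
    (h : expectedSum Pr β (fun t ω => logLoss (c t ω)) ≠ ⊤) (t : ℕ) : ∀ᵐ ω ∂Pr, 0 < c t ω := by
  filter_upwards [ae_lt_top_of_expectedSum hβ (fun t => measurable_logLoss.comp (hc t)) h t]
    with ω hω
  by_contra hle
  simp only [Function.comp_apply, logLoss_of_nonpos (not_lt.1 hle), lt_self_iff_false] at hω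

/-- A plan of finite utility is not dominated by a plan that consumes at least as much unless both
coincide. -/
theorem ae_eq_of_le_of_lifetimeUtility_le (hβ : 0 < β) {c c' : ℕ → Ω → ℝ}
    (hc : ∀ t, Measurable (c t)) (hc' : ∀ t, Measurable (c' t))
    (hle : ∀ t, ∀ᵐ ω ∂Pr, c t ω ≤ c' t ω)
    (hgain : expectedSum Pr β (fun t ω => logGain (c t ω)) ≠ ⊤)
    (hbot : lifetimeUtility Pr β c ≠ ⊥)
    (h : lifetimeUtility Pr β c' ≤ lifetimeUtility Pr β c) (t : ℕ) :
    ∀ᵐ ω ∂Pr, c t ω = c' t ω := by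
  have hloss := expectedSum_logLoss_ne_top hbot
  have hg : expectedSum Pr β (fun t ω => logGain (c t ω)) ≤
      expectedSum Pr β (fun t ω => logGain (c' t ω)) :=
    expectedSum_mono fun t => (hle t).mono fun ω hω => logGain_mono hω
  have hl : expectedSum Pr β (fun t ω => logLoss (c' t ω)) ≤
      expectedSum Pr β (fun t ω => logLoss (c t ω)) :=
    expectedSum_mono fun t => (hle t).mono fun ω hω => logLoss_anti hω
  have hloss' := ne_top_of_le_ne_top hloss hl
  rw [lifetimeUtility_eq, lifetimeUtility_eq] at h
  have hsum := add_le_add_of_coe_sub_le hloss' hgain hloss h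
  have hg' : expectedSum Pr β (fun t ω => logGain (c' t ω)) ≤
      expectedSum Pr β (fun t ω => logGain (c t ω)) :=
    (ENNReal.add_le_add_iff_right hloss).1 (hsum.trans (by gcongr))
  have hl' : expectedSum Pr β (fun t ω => logLoss (c t ω)) ≤
      expectedSum Pr β (fun t ω => logLoss (c' t ω)) :=
    (ENNReal.add_le_add_iff_left hgain).1 (le_trans (by gcongr) hsum)
  filter_upwards [hle t, ae_pos_of_expectedSum_logLoss hβ hc hloss t,
    ae_eq_of_expectedSum_le hβ (fun t => measurable_logGain.comp (hc' t))
      (fun t => (hle t).mono fun ω hω => logGain_mono hω) hgain hg' t,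
    ae_eq_of_expectedSum_le hβ (fun t => measurable_logLoss.comp (hc t))
      (fun t => (hle t).mono fun ω hω => logLoss_anti hω) hloss' hl' t] with ω h1 h2 h3 h4
  exact eq_of_logGain_eq_of_logLoss_eq h2 h1 h3 h4.symm

/-- This is `log x - log y = (x / y - 1) - φ`, where `φ ≥ 0` is the gap in the tangent inequality of
`log`, rearranged into nonnegative terms so that it can be summed in `ℝ≥0∞`. -/
theorem logGain_add_logLoss_add {x y : ℝ} (hx : 0 < x) (hy : 0 < y) :
    logGain x + logLoss y + ENNReal.ofReal (x / y - 1 - Real.log (x / y)) + 1 =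
      logGain y + logLoss x + ENNReal.ofReal (x / y) := by
  have hxy : 0 < x / y := div_pos hx hy
  have hlog : Real.log (x / y) = Real.log x - Real.log y := Real.log_div hx.ne' hy.ne'
  have h1 := Real.log_le_sub_one_of_pos hxy
  rw [logGain_of_pos hx, logGain_of_pos hy, logLoss_of_pos hx, logLoss_of_pos hy]
  have key : ∀ u : ℝ, ENNReal.ofReal u = ENNReal.ofReal (max u 0) := fun u => by
    rcases le_total u 0 with h | h <;> simp [h, ENNReal.ofReal_of_nonpos]
  have hu : 0 ≤ x / y - 1 - Real.log (x / y) := by linarith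
  rw [key (Real.log x), key (-Real.log y), key (Real.log y), key (-Real.log x),
    ← ENNReal.ofReal_one, ← ENNReal.ofReal_add (by positivity) (by positivity),
    ← ENNReal.ofReal_add (by positivity) hu, ← ENNReal.ofReal_add (by positivity) zero_le_one,
    ← ENNReal.ofReal_add (by positivity) (by positivity),
    ← ENNReal.ofReal_add (by positivity) (by positivity)]
  have h2 := max_zero_sub_max_neg_zero_eq_self (Real.log x)
  have h3 := max_zero_sub_max_neg_zero_eq_self (Real.log y)
  congr 1
  linarith

theorem tsum_ofReal_pow (hβ : 0 < β) (hβ1 : β < 1) :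
    ∑' t : ℕ, ENNReal.ofReal (β ^ t) = ENNReal.ofReal (1 / (1 - β)) := by
  rw [← ENNReal.ofReal_tsum_of_nonneg (fun t => (pow_pos hβ t).le)
    (summable_geometric_of_lt_one hβ.le hβ1), tsum_geometric_of_lt_one hβ.le hβ1, one_div]

/-- A plan `c` whose value at the supporting prices `β ^ t / c'_t` of `c'` is at most the value of
`c'`, and whose utility is at least that of `c'`, coincides with `c'`. -/
theorem ae_eq_of_supporting [IsProbabilityMeasure Pr] (hβ : 0 < β) (hβ1 : β < 1)
    {c c' : ℕ → Ω → ℝ} (hc : ∀ t, Measurable (c t)) (hc' : ∀ t, Measurable (c' t))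
    (hpos : ∀ t ω, 0 < c' t ω)
    (hsupp : ∀ᵐ ω ∂Pr, ∑' t : ℕ, ENNReal.ofReal (β ^ t) * ENNReal.ofReal (c t ω / c' t ω) ≤
      ENNReal.ofReal (1 / (1 - β)))
    (hgain : expectedSum Pr β (fun t ω => logGain (c t ω)) ≠ ⊤)
    (hbot : lifetimeUtility Pr β c ≠ ⊥)
    (h : lifetimeUtility Pr β c' ≤ lifetimeUtility Pr β c) (t : ℕ) :
    ∀ᵐ ω ∂Pr, c t ω = c' t ω := by
  have hloss := expectedSum_logLoss_ne_top hbot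
  have hcpos := ae_pos_of_expectedSum_logLoss hβ hc hloss
  have hGm : ∀ t, Measurable fun ω => logGain (c t ω) := fun t => measurable_logGain.comp (hc t)
  have hGm' : ∀ t, Measurable fun ω => logGain (c' t ω) := fun t => measurable_logGain.comp (hc' t)
  have hLm : ∀ t, Measurable fun ω => logLoss (c t ω) := fun t => measurable_logLoss.comp (hc t)
  have hLm' : ∀ t, Measurable fun ω => logLoss (c' t ω) := fun t => measurable_logLoss.comp (hc' t)
  have hratio : expectedSum Pr β (fun t ω => ENNReal.ofReal (c t ω / c' t ω)) ≤
      ENNReal.ofReal (1 / (1 - β)) := by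
    refine (lintegral_mono_ae hsupp).trans ?_
    simp
  have hone : expectedSum Pr β (fun _ _ => 1) = ENNReal.ofReal (1 / (1 - β)) := by
    simp [expectedSum, tsum_ofReal_pow hβ hβ1]
  -- By `log (c / c') ≤ c / c' - 1`, the loss of `c'` is at most that of `c` plus the ratio.
  have hloss' : expectedSum Pr β (fun t ω => logLoss (c' t ω)) ≠ ⊤ := by
    refine ne_top_of_le_ne_top (ENNReal.add_ne_top.2
      ⟨hloss, ne_top_of_le_ne_top ENNReal.ofReal_ne_top hratio⟩) ?_
    rw [← expectedSum_add hLm]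
    refine expectedSum_mono fun t => ?_
    filter_upwards [hcpos t] with ω hω
    have h1 := hpos t ω
    rw [logLoss_of_pos hω, logLoss_of_pos h1]
    refine le_trans (ENNReal.ofReal_le_ofReal ?_) ENNReal.ofReal_add_le
    have h2 := Real.log_le_sub_one_of_pos (div_pos hω h1)
    rw [Real.log_div hω.ne' h1.ne'] at h2
    linarith
  rw [lifetimeUtility_eq, lifetimeUtility_eq] at h
  have hsum := add_le_add_of_coe_sub_le hloss' hgain hloss h
  set φ : ℕ → Ω → ℝ≥0∞ :=
    fun t ω => ENNReal.ofReal (c t ω / c' t ω - 1 - Real.log (c t ω / c' t ω)) with hφ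
  have hφm : ∀ t, Measurable (φ t) := fun t => by
    have h1 : Measurable fun ω => c t ω / c' t ω := (hc t).div (hc' t)
    exact ((h1.sub_const 1).sub (Real.measurable_log.comp h1)).ennreal_ofReal
  have hGL : ∀ t, Measurable fun ω => logGain (c t ω) + logLoss (c' t ω) :=
    fun t => (hGm t).add (hLm' t)
  have hGLφ : ∀ t, Measurable fun ω => logGain (c t ω) + logLoss (c' t ω) + φ t ω :=
    fun t => (hGL t).add (hφm t)
  have hGL' : ∀ t, Measurable fun ω => logGain (c' t ω) + logLoss (c t ω) :=
    fun t => (hGm' t).add (hLm t)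
  -- Both `∑ β ^ t` and the bound on the supporting value equal `1 / (1 - β)`. After cancelling
  -- them, the utility comparison `hsum` leaves no room for a positive `φ`.
  have hid : expectedSum Pr β (fun t ω => logGain (c t ω)) +
        expectedSum Pr β (fun t ω => logLoss (c' t ω)) + expectedSum Pr β φ +
        ENNReal.ofReal (1 / (1 - β)) ≤
      expectedSum Pr β (fun t ω => logGain (c' t ω)) +
        expectedSum Pr β (fun t ω => logLoss (c t ω)) + ENNReal.ofReal (1 / (1 - β)) := by
    rw [← hone, ← expectedSum_add hGm, ← expectedSum_add hGL,
      ← expectedSum_add hGLφ, hone]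
    refine le_trans ?_ (add_le_add le_rfl hratio)
    rw [← expectedSum_add hGm', ← expectedSum_add hGL']
    refine expectedSum_mono fun t => ?_
    filter_upwards [hcpos t] with ω hω
    exact (logGain_add_logLoss_add hω (hpos t ω)).le
  have hfin : expectedSum Pr β (fun t ω => logGain (c t ω)) +
      expectedSum Pr β (fun t ω => logLoss (c' t ω)) ≠ ⊤ := ENNReal.add_ne_top.2 ⟨hgain, hloss'⟩
  have hφ0 : expectedSum Pr β φ ≤ 0 := by
    have h1 := (ENNReal.add_le_add_iff_right ENNReal.ofReal_ne_top).1 hid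
    have h2 := h1.trans hsum
    exact (ENNReal.add_le_add_iff_left hfin).1 (h2.trans_eq (add_zero _).symm)
  have hz : expectedSum Pr β (fun _ _ => (0 : ℝ≥0∞)) = 0 := by simp [expectedSum]
  filter_upwards [ae_eq_of_expectedSum_le (Pr := Pr) hβ hφm (fun t => ae_of_all _ fun ω => zero_le)
    (by rw [hz]; exact ENNReal.zero_ne_top) (by rw [hz]; exact hφ0) t, hcpos t] with ω h1 h2
  have h3 := ENNReal.ofReal_eq_zero.1 h1.symm
  have h4 := div_pos h2 (hpos t ω)
  by_contra hne
  have h5 : c t ω / c' t ω ≠ 1 := fun he => hne ((div_eq_one_iff_eq (hpos t ω).ne').1 he)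
  have := Real.log_lt_sub_one_of_pos h4 h5
  linarith

end

/-! ### Optimal consumption along a single path -/

section Path

variable {β : ℝ} {c s w w' ρ : ℕ → ℝ}

/-- Deflating by the path `w'` of an agent with saving rate `β`, the value of consumption up to
some date and of wealth at that date does not exceed initial wealth. -/
theorem sum_deflated_consumption_add_le (hβ : 0 < β) (hw' : ∀ t, 0 < w' t) (hρ : ∀ t, 0 < ρ t)
    (hw'succ : ∀ t, w' (t + 1) = β * ρ t * w' t) (h0 : w 0 = w' 0)
    (hbudget : ∀ t, c t + s t = w t) (hwsucc : ∀ t, w (t + 1) ≤ ρ t * s t) (n : ℕ) :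
    ∑ t ∈ Finset.range n, β ^ t * (c t / w' t) + β ^ n * (w n / w' n) ≤ 1 := by
  induction n with
  | zero => simp [h0, (hw' 0).ne']
  | succ n ih =>
    refine le_trans ?_ ih
    rw [Finset.sum_range_succ, add_assoc]
    gcongr
    -- As `w'` grows by the factor `β * ρ n`, saving `s n` has the same deflated value as the most
    -- it can yield tomorrow, `ρ n * s n`.
    have h1 : w (n + 1) / w' (n + 1) ≤ ρ n * s n / w' (n + 1) :=
      div_le_div_of_nonneg_right (hwsucc n) (hw' _).le
    have h2 : ρ n * s n / w' (n + 1) = s n / w' n / β := by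
      rw [hw'succ]
      have := (hw' n).ne'
      have := (hρ n).ne'
      field_simp
    calc β ^ n * (c n / w' n) + β ^ (n + 1) * (w (n + 1) / w' (n + 1))
        ≤ β ^ n * (c n / w' n) + β ^ (n + 1) * (s n / w' n / β) := by rw [← h2]; gcongr
      _ = β ^ n * ((c n + s n) / w' n) := by rw [pow_succ]; field_simp
      _ = β ^ n * (w n / w' n) := by rw [hbudget]

/-- The relative shortfall `e n = 1 - w n / w' n` lies in `[0, 1]` and satisfies `e n ≤ β * e (n +
1)`; a positive one would grow like `β ^ (-m)`. -/
theorem wealth_eq_of_consumption_eq (hβ : 0 < β) (hβ1 : β < 1) (hw' : ∀ t, 0 < w' t)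
    (hρ : ∀ t, 0 < ρ t) (hw'succ : ∀ t, w' (t + 1) = β * ρ t * w' t) (h0 : w 0 = w' 0)
    (hbudget : ∀ t, c t + s t = w t) (hwsucc : ∀ t, w (t + 1) ≤ ρ t * s t) (hw : ∀ t, 0 ≤ w t)
    (hc : ∀ t, c t = (1 - β) * w' t) (n : ℕ) : w n = w' n := by
  set e : ℕ → ℝ := fun n => 1 - w n / w' n with he
  have hle : ∀ n, 0 ≤ e n := fun n => by
    have h1 := sum_deflated_consumption_add_le hβ hw' hρ hw'succ h0 hbudget hwsucc n
    have h2 : ∀ t, β ^ t * (c t / w' t) = β ^ t - β ^ (t + 1) := fun t => by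
      rw [hc, mul_div_cancel_right₀ _ (hw' t).ne']; ring
    simp only [h2, Finset.sum_range_sub', pow_zero] at h1
    have h3 := pow_pos hβ n
    have h4 : β ^ n * (w n / w' n) ≤ β ^ n * 1 := by linarith
    have := le_of_mul_le_mul_left h4 h3
    simp only [he]; linarith
  have hle1 : ∀ n, e n ≤ 1 := fun n => by
    have := div_nonneg (hw n) (hw' n).le
    simp only [he]; linarith
  have hstep : ∀ n, e n ≤ β * e (n + 1) := fun n => by
    have h1 : w (n + 1) / w' (n + 1) ≤ s n / w' n / β := by
      have h2 : ρ n * s n / w' (n + 1) = s n / w' n / β := by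
        rw [hw'succ]
        have := (hw' n).ne'
        have := (hρ n).ne'
        field_simp
      rw [← h2]
      exact div_le_div_of_nonneg_right (hwsucc n) (hw' _).le
    have h3 : s n / w' n = w n / w' n - (1 - β) := by
      have := (hw' n).ne'
      rw [← hbudget, hc]; field_simp; ring
    rw [h3, le_div_iff₀ hβ] at h1
    simp only [he]; linarith
  have hiter : ∀ m, e n ≤ β ^ m * e (n + m) := fun m => by
    induction m with
    | zero => simp
    | succ m ih =>
      refine ih.trans ?_
      calc β ^ m * e (n + m) ≤ β ^ m * (β * e (n + m + 1)) := by gcongr; exact hstep _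
        _ = β ^ (m + 1) * e (n + (m + 1)) := by rw [← add_assoc]; ring
  have hz : e n ≤ 0 := by
    refine ge_of_tendsto' (tendsto_pow_atTop_nhds_zero_of_lt_one hβ.le hβ1) fun m => ?_
    refine (hiter m).trans ?_
    have := pow_pos hβ m
    nlinarith [hle1 (n + m)]
  have h1 : w n / w' n = 1 := by
    have := hle n
    simp only [he] at this hz
    linarith
  exact (div_eq_one_iff_eq (hw' n).ne').1 h1

end Path

/-! ### Returns and the optimum of a single agent. -/

namespace Primitives

variable {N : ℕ} (E : Primitives N)

/-- Gross return on the asset between `t` and `t + 1`. -/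
noncomputable def assetReturn (price : ℕ → ℝ) (t : ℕ) : ℝ :=
  (price (t + 1) + E.D (t + 1)) / price t

/-- The higher one of the returns on capital and on the asset. -/
noncomputable def bestReturn (price : ℕ → ℝ) (t : ℕ) (n : Fin (N + 1)) : ℝ :=
  max (E.z n) (E.assetReturn price t)

theorem z_nonneg (n : Fin (N + 1)) : 0 ≤ E.z n := by
  rw [← E.z_zero]
  exact E.z_strictMono.monotone (Fin.zero_le n)

theorem z_pos {n : Fin (N + 1)} (hn : n ≠ 0) : 0 < E.z n := by
  rw [← E.z_zero]
  exact E.z_strictMono (Fin.pos_iff_ne_zero.2 hn)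

theorem z_le_last (n : Fin (N + 1)) : E.z n ≤ E.z (Fin.last N) :=
  E.z_strictMono.monotone (Fin.le_last n)

theorem assetReturn_pos {price : ℕ → ℝ} (hP : ∀ t, 0 < price t) (t : ℕ) :
    0 < E.assetReturn price t :=
  div_pos (add_pos_of_pos_of_nonneg (hP _) (E.D_nonneg _)) (hP t)

theorem bestReturn_pos {price : ℕ → ℝ} (hP : ∀ t, 0 < price t) (t : ℕ) (n : Fin (N + 1)) :
    0 < E.bestReturn price t n := lt_max_of_lt_right (E.assetReturn_pos hP t)

theorem assetReturn_mul {price : ℕ → ℝ} (hP : ∀ t, 0 < price t) (t : ℕ) :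
    E.assetReturn price t * price t = price (t + 1) + E.D (t + 1) :=
  div_mul_cancel₀ _ (hP t).ne'

end Primitives

namespace Population

variable {N : ℕ} {E : Primitives N} {I Ω : Type*} [MeasurableSpace I] [mΩ : MeasurableSpace Ω]
  {lam : Measure I} {Pr : Measure Ω} (pop : Population E lam Pr) {price : ℕ → ℝ} {i : I}

/-- Wealth at time `0`, which is deterministic. -/
noncomputable def initialWealth (price : ℕ → ℝ) (i : I) : ℝ :=
  E.z (pop.prevType i) * pop.k₀ i + (price 0 + E.D 0) * pop.x₀ i

/-- Wealth when the fraction `β` of wealth is saved each period at the best return. -/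
noncomputable def targetWealth (price : ℕ → ℝ) (i : I) : ℕ → Ω → ℝ
  | 0, _ => pop.initialWealth price i
  | t + 1, ω => E.β * E.bestReturn price t (pop.type t i ω) * targetWealth price i t ω

theorem measurable_comp_type {t : ℕ} (f : Fin (N + 1) → ℝ) :
    Measurable[pop.info i t] fun ω => f (pop.type t i ω) :=
  (Measurable.of_discrete (f := f)).comp (pop.type_adapted i t)

theorem measurable_targetWealth (t : ℕ) :
    Measurable[pop.info i t] (pop.targetWealth price i t) := by
  induction t with
  | zero => exact measurable_const
  | succ t ih =>
    have h : Measurable[pop.info i t] (pop.targetWealth price i (t + 1)) :=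
      (pop.measurable_comp_type fun n => E.β * E.bestReturn price t n).mul ih
    exact h.mono ((pop.info i).mono t.le_succ) le_rfl

theorem targetWealth_pos (hP : ∀ t, 0 < price t) (h0 : 0 < pop.initialWealth price i) (t : ℕ)
    (ω : Ω) : 0 < pop.targetWealth price i t ω := by
  induction t with
  | zero => exact h0
  | succ t ih => exact mul_pos (mul_pos E.β_pos (E.bestReturn_pos hP t _)) ih

theorem exists_targetWealth_le (t : ℕ) : ∃ B, ∀ ω, |pop.targetWealth price i t ω| ≤ B := by
  induction t with
  | zero => exact ⟨|pop.initialWealth price i|, fun ω => le_rfl⟩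
  | succ t ih =>
    obtain ⟨B, hB⟩ := ih
    refine ⟨(∑ n, |E.β * E.bestReturn price t n|) * B, fun ω => ?_⟩
    rw [targetWealth, abs_mul]
    refine mul_le_mul ?_ (hB ω) (abs_nonneg _) (Finset.sum_nonneg fun _ _ => abs_nonneg _)
    exact Finset.single_le_sum (f := fun n => |E.β * E.bestReturn price t n|)
      (fun n _ => abs_nonneg _) (Finset.mem_univ (pop.type t i ω))

/-- Saving the fraction `β` of wealth at the best return is feasible. -/
theorem isFeasible_target (hP : ∀ t, 0 < price t) (h0 : 0 < pop.initialWealth price i) :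
    pop.IsFeasible price i (fun t ω => (1 - E.β) * pop.targetWealth price i t ω)
      (fun t ω => (if E.assetReturn price t < E.z (pop.type t i ω) then E.β else 0) *
        pop.targetWealth price i t ω)
      (fun t ω => (if E.assetReturn price t < E.z (pop.type t i ω) then 0 else E.β / price t) *
        pop.targetWealth price i t ω) where
  c_adapted t := (pop.measurable_targetWealth t).const_mul _
  k_adapted t := (pop.measurable_comp_type fun n =>
    if E.assetReturn price t < E.z n then E.β else 0).mul (pop.measurable_targetWealth t)
  x_adapted t := (pop.measurable_comp_type fun n =>
    if E.assetReturn price t < E.z n then 0 else E.β / price t).mul (pop.measurable_targetWealth t)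
  c_nonneg t := ae_of_all _ fun ω =>
    mul_nonneg (sub_nonneg.2 E.β_lt_one.le) (pop.targetWealth_pos hP h0 t ω).le
  k_nonneg t := ae_of_all _ fun ω => by
    refine mul_nonneg ?_ (pop.targetWealth_pos hP h0 t ω).le
    split_ifs
    exacts [E.β_pos.le, le_rfl]
  x_nonneg t := ae_of_all _ fun ω => by
    refine mul_nonneg ?_ (pop.targetWealth_pos hP h0 t ω).le
    split_ifs
    exacts [le_rfl, (div_pos E.β_pos (hP t)).le]
  budget t := ae_of_all _ fun ω => by
    have hw : ∀ t, pop.wealth price i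
        (fun t ω => (if E.assetReturn price t < E.z (pop.type t i ω) then E.β else 0) *
          pop.targetWealth price i t ω)
        (fun t ω => (if E.assetReturn price t < E.z (pop.type t i ω) then 0 else E.β / price t) *
          pop.targetWealth price i t ω) t ω = pop.targetWealth price i t ω := by
      rintro (_ | t)
      · rfl
      · simp only [wealth, targetWealth, Primitives.bestReturn]
        have h1 := E.assetReturn_mul hP t
        have h2 := (hP t).ne'
        split_ifs with h
        · rw [max_eq_left h.le]; ring
        · rw [max_eq_right (not_lt.1 h), ← h1]; field_simp; ring
    rw [hw]
    have h2 := (hP t).ne'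
    split_ifs
    · ring
    · field_simp; ring

variable {c k x : ℕ → Ω → ℝ}

theorem IsFeasible.measurable_c {pop : Population E lam Pr} (h : pop.IsFeasible price i c k x)
    (t : ℕ) : Measurable (c t) := (h.c_adapted t).mono ((pop.info i).le t) le_rfl

theorem IsOptimal.initialWealth_pos [IsProbabilityMeasure Pr] {pop : Population E lam Pr}
    (hP : ∀ t, 0 ≤ price t) (h : pop.IsOptimal price i c k x) :
    0 < pop.initialWealth price i := by
  have hpos := ae_pos_of_expectedSum_logLoss E.β_pos (fun t => h.feasible.measurable_c t)
    (expectedSum_logLoss_ne_top h.utility_ne_bot) 0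
  obtain ⟨ω, h1, h2, h3, h4⟩ := (hpos.and ((h.feasible.k_nonneg 0).and
    ((h.feasible.x_nonneg 0).and (h.feasible.budget 0)))).exists
  have h5 : pop.wealth price i k x 0 ω = pop.initialWealth price i := rfl
  rw [← h5, ← h4]
  have := mul_nonneg (hP 0) h3
  linarith

/-- With logarithmic utility, the optimal plan saves the fraction `β` of wealth, and invests only
at the best return. -/
theorem IsOptimal.wealth_eq [IsProbabilityMeasure Pr] {pop : Population E lam Pr}
    (hP : ∀ t, 0 < price t) (h : pop.IsOptimal price i c k x)
    (hgain : expectedSum Pr E.β (fun t ω => logGain (c t ω)) ≠ ⊤) :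
    ∀ᵐ ω ∂Pr, ∀ t, pop.wealth price i k x t ω = pop.targetWealth price i t ω ∧
      k t ω + price t * x t ω = E.β * pop.targetWealth price i t ω ∧
      (E.z (pop.type t i ω) < E.assetReturn price t → k t ω = 0) := by
  have h0 := h.initialWealth_pos fun t => (hP t).le
  have hβ1 : 0 < 1 - E.β := sub_pos.2 E.β_lt_one
  have hfeas : ∀ᵐ ω ∂Pr, ∀ t, (0 ≤ c t ω ∧ 0 ≤ k t ω ∧ 0 ≤ x t ω) ∧
      c t ω + k t ω + price t * x t ω = pop.wealth price i k x t ω := by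
    refine ae_all_iff.2 fun t => ?_
    filter_upwards [h.feasible.c_nonneg t, h.feasible.k_nonneg t, h.feasible.x_nonneg t,
      h.feasible.budget t] with ω h1 h2 h3 h4
    exact ⟨⟨h1, h2, h3⟩, h4⟩
  have hpath : ∀ ω, (∀ t, (0 ≤ c t ω ∧ 0 ≤ k t ω ∧ 0 ≤ x t ω) ∧
      c t ω + k t ω + price t * x t ω = pop.wealth price i k x t ω) →
      ∀ t, pop.wealth price i k x (t + 1) ω ≤
        E.bestReturn price t (pop.type t i ω) * (k t ω + price t * x t ω) := by
    intro ω hω t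
    obtain ⟨⟨h1, h2, h3⟩, h4⟩ := hω t
    rw [wealth, ← E.assetReturn_mul hP t]
    have h5 : E.z (pop.type t i ω) ≤ E.bestReturn price t (pop.type t i ω) := le_max_left _ _
    have h6 : E.assetReturn price t ≤ E.bestReturn price t (pop.type t i ω) := le_max_right _ _
    have h7 := mul_nonneg (hP t).le h3
    nlinarith [mul_le_mul_of_nonneg_right h5 h2, mul_le_mul_of_nonneg_right h6 h7]
  -- Target consumption is `(1 - β)` times target wealth, so the deflated budget inequality bounds
  -- the value of any feasible plan by `1 / (1 - β)`.
  have hsupp : ∀ᵐ ω ∂Pr, ∑' t : ℕ, ENNReal.ofReal (E.β ^ t) *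
      ENNReal.ofReal (c t ω / ((1 - E.β) * pop.targetWealth price i t ω)) ≤
      ENNReal.ofReal (1 / (1 - E.β)) := by
    filter_upwards [hfeas] with ω hω
    refine ENNReal.tsum_le_of_sum_range_le fun n => ?_
    have hw' := fun t => pop.targetWealth_pos hP h0 t ω
    have hterm : ∀ t, 0 ≤ E.β ^ t * (c t ω / pop.targetWealth price i t ω) := fun t =>
      mul_nonneg (pow_pos E.β_pos t).le (div_nonneg (hω t).1.1 (hw' t).le)
    have heq : ∀ t, ENNReal.ofReal (E.β ^ t) *
        ENNReal.ofReal (c t ω / ((1 - E.β) * pop.targetWealth price i t ω)) =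
        ENNReal.ofReal (E.β ^ t * (c t ω / pop.targetWealth price i t ω) / (1 - E.β)) := fun t => by
      rw [← ENNReal.ofReal_mul (pow_pos E.β_pos t).le]
      congr 1
      have := (hw' t).ne'
      field_simp
    simp only [heq]
    rw [← ENNReal.ofReal_sum_of_nonneg fun t _ => div_nonneg (hterm t) hβ1.le, ← Finset.sum_div]
    refine ENNReal.ofReal_le_ofReal (div_le_div_of_nonneg_right ?_ hβ1.le)
    have h1 := sum_deflated_consumption_add_le (c := fun t => c t ω)
      (s := fun t => k t ω + price t * x t ω) (w := fun t => pop.wealth price i k x t ω)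
      E.β_pos hw' (fun t => E.bestReturn_pos hP t (pop.type t i ω)) (fun t => rfl) rfl
      (fun t => by rw [← (hω t).2]; ring) (hpath ω hω) n
    have h2 : 0 ≤ E.β ^ n * (pop.wealth price i k x n ω / pop.targetWealth price i n ω) := by
      refine mul_nonneg (pow_pos E.β_pos n).le (div_nonneg ?_ (hw' n).le)
      obtain ⟨⟨h1, h2, h3⟩, h4⟩ := hω n
      have := mul_nonneg (hP n).le h3
      linarith
    linarith
  have hc := ae_all_iff.2 (ae_eq_of_supporting E.β_pos E.β_lt_one
    (fun t => h.feasible.measurable_c t)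
    (fun t => (pop.isFeasible_target hP h0).measurable_c t)
    (fun t ω => mul_pos hβ1 (pop.targetWealth_pos hP h0 t ω)) hsupp hgain h.utility_ne_bot
    (h.maximal _ _ _ (pop.isFeasible_target hP h0)))
  filter_upwards [hfeas, hc] with ω hω hcω
  have hw : ∀ t, pop.wealth price i k x t ω = pop.targetWealth price i t ω :=
    wealth_eq_of_consumption_eq (c := fun t => c t ω)
      (s := fun t => k t ω + price t * x t ω) (w := fun t => pop.wealth price i k x t ω)
      E.β_pos E.β_lt_one (fun t => pop.targetWealth_pos hP h0 t ω)
      (fun t => E.bestReturn_pos hP t (pop.type t i ω)) (fun t => rfl) rfl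
      (fun t => by rw [← (hω t).2]; ring) (hpath ω hω)
      (fun t => by
        obtain ⟨⟨h1, h2, h3⟩, h4⟩ := hω t
        have := mul_nonneg (hP t).le h3
        linarith) hcω
  intro t
  have hs : k t ω + price t * x t ω = E.β * pop.targetWealth price i t ω := by
    have h1 := (hω t).2
    rw [hw, hcω] at h1
    linarith
  refine ⟨hw t, hs, fun hz => ?_⟩
  have h1 := hw (t + 1)
  rw [wealth, targetWealth, Primitives.bestReturn, max_eq_right hz.le,
    ← E.assetReturn_mul hP t] at h1
  -- Tomorrow's wealth equals the best return on all savings, so the return forgone on capital must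
  -- vanish.
  have h2 : (E.assetReturn price t - E.z (pop.type t i ω)) * k t ω = 0 := by
    linear_combination E.assetReturn price t * hs - h1
  exact (mul_eq_zero.1 h2).resolve_left (sub_pos.2 hz).ne'

/-- If the asset is free, it has no payoff in the next period. -/
theorem IsOptimal.payoff_eq_zero [IsProbabilityMeasure Pr] {pop : Population E lam Pr}
    (hP : ∀ t, 0 ≤ price t) (h : pop.IsOptimal price i c k x)
    (hgain : expectedSum Pr E.β (fun t ω => logGain (c t ω)) ≠ ⊤) {t : ℕ} (ht : price t = 0) :
    price (t + 1) + E.D (t + 1) = 0 := by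
  set b := price (t + 1) + E.D (t + 1) with hb
  have hb0 : 0 ≤ b := add_nonneg (hP _) (E.D_nonneg _)
  -- The deviation buys one more unit of the free asset at `t` and consumes its payoff at `t + 1`.
  set c' : ℕ → Ω → ℝ := fun s ω => c s ω + if s = t + 1 then b else 0 with hc'
  set x' : ℕ → Ω → ℝ := fun s ω => x s ω + if s = t then 1 else 0 with hx'
  have hw : ∀ s ω, pop.wealth price i k x' s ω =
      pop.wealth price i k x s ω + if s = t + 1 then b else 0 := by
    rintro (_ | s) ω
    · simp [wealth]
    · simp only [wealth, hx', Nat.add_right_cancel_iff]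
      split_ifs with hs
      · subst hs; rw [hb]; ring
      · ring
  have hpx : ∀ s ω, price s * x' s ω = price s * x s ω := fun s ω => by
    simp only [hx']
    split_ifs with hs
    · subst hs; simp [ht]
    · simp
  have hcc' : ∀ s ω, c s ω ≤ c' s ω := fun s ω => by
    simp only [hc']
    split_ifs <;> linarith
  have hfeas : pop.IsFeasible price i c' k x' :=
    { c_adapted := fun s => (h.feasible.c_adapted s).add_const _
      k_adapted := h.feasible.k_adapted
      x_adapted := fun s => (h.feasible.x_adapted s).add_const _
      c_nonneg := fun s => (h.feasible.c_nonneg s).mono fun ω hω => hω.trans (hcc' s ω)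
      k_nonneg := h.feasible.k_nonneg
      x_nonneg := fun s => (h.feasible.x_nonneg s).mono fun ω hω => by
        simp only [hx']
        split_ifs <;> linarith
      budget := fun s => (h.feasible.budget s).mono fun ω hω => by
        rw [hw, hpx, ← hω]
        simp only [hc']
        ring }
  obtain ⟨ω, hω⟩ := (ae_eq_of_le_of_lifetimeUtility_le E.β_pos
    (fun t => h.feasible.measurable_c t) (fun t => hfeas.measurable_c t)
    (fun s => ae_of_all _ fun ω => hcc' s ω) hgain h.utility_ne_bot
    (h.maximal _ _ _ hfeas) (t + 1)).exists
  simp only [hc', if_true] at hω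
  linarith

/-- Expected target wealth by type evolves according to the transition matrix weighted by the
returns on savings. -/
theorem integral_targetWealth_succ [IsProbabilityMeasure Pr] (t : ℕ) (n' : Fin (N + 1)) :
    ∫ ω, (if pop.type (t + 1) i ω = n' then pop.targetWealth price i (t + 1) ω else 0) ∂Pr =
      ∑ n, E.trans n n' * (E.β * E.bestReturn price t n) *
        ∫ ω, (if pop.type t i ω = n then pop.targetWealth price i t ω else 0) ∂Pr := by
  set Y : Ω → ℝ := pop.targetWealth price i (t + 1) with hY
  set g : Ω → ℝ := {ω | pop.type (t + 1) i ω = n'}.indicator (fun _ => (1 : ℝ)) with hg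
  have hle := (pop.info i).le
  -- The productivity governing the return from `t` to `t + 1` is known at `t`, so `Y` can be pulled
  -- out of the conditional expectation.
  have hYm : Measurable[pop.info i t] Y :=
    (pop.measurable_comp_type fun n => E.β * E.bestReturn price t n).mul
      (pop.measurable_targetWealth t)
  have hset : ∀ t n, MeasurableSet {ω | pop.type t i ω = n} := fun t n =>
    (pop.type_adapted i t).mono (hle t) le_rfl (measurableSet_singleton n)
  have hwint : ∀ t, Integrable (pop.targetWealth price i t) Pr := fun t => by
    obtain ⟨B, hB⟩ := pop.exists_targetWealth_le (price := price) (i := i) t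
    exact Integrable.of_bound
      ((pop.measurable_targetWealth t).mono (hle t) le_rfl).aestronglyMeasurable B
      (ae_of_all _ hB)
  have hind : ∀ t n, Integrable
      (fun ω => if pop.type t i ω = n then pop.targetWealth price i t ω else 0) Pr := fun t n => by
    have : (fun ω => if pop.type t i ω = n then pop.targetWealth price i t ω else 0) =
        {ω | pop.type t i ω = n}.indicator (pop.targetWealth price i t) := by
      ext ω
      simp [Set.indicator_apply]
    rw [this]
    exact (hwint t).indicator (hset t n)
  have hgint : Integrable g Pr := (integrable_const (1 : ℝ)).indicator (hset (t + 1) n')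
  have hYg : (fun ω => if pop.type (t + 1) i ω = n' then Y ω else 0) = Y * g := by
    ext ω
    by_cases h : pop.type (t + 1) i ω = n' <;> simp [hg, h]
  have hYgint : Integrable (Y * g) Pr := by
    rw [← hYg]
    exact hind (t + 1) n'
  have h1 : ∫ ω, (Y * g) ω ∂Pr = ∫ ω, Y ω * E.trans (pop.type t i ω) n' ∂Pr := by
    rw [← integral_condExp (hle t)]
    refine integral_congr_ae ?_
    filter_upwards [condExp_mul_of_stronglyMeasurable_left hYm.stronglyMeasurable hYgint hgint,
      pop.markov i t n'] with ω h1 h2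
    rw [h1, Pi.mul_apply, h2]
  rw [hYg, h1]
  have h2 : ∀ ω, Y ω * E.trans (pop.type t i ω) n' = ∑ n, E.trans n n' *
      (E.β * E.bestReturn price t n) *
      (if pop.type t i ω = n then pop.targetWealth price i t ω else 0) := fun ω => by
    simp only [mul_ite, mul_zero, Finset.sum_ite_eq, Finset.mem_univ, if_true]
    rw [hY, targetWealth]; ring
  simp only [h2]
  rw [integral_finsetSum]
  · simp only [integral_const_mul]
  · exact fun n _ => (hind t n).const_mul _

end Population

/-! ### Growth of wealth by type and of the price. -/

theorem exists_pos_of_mul_apply_pos {n : Type*} [Fintype n] {A B : Matrix n n ℝ}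
    (hA : ∀ i j, 0 ≤ A i j) (hB : ∀ i j, 0 ≤ B i j) {i j : n} (h : 0 < (A * B) i j) :
    ∃ l, 0 < A i l ∧ 0 < B l j := by
  rw [Matrix.mul_apply] at h
  obtain ⟨l, -, hl⟩ := Finset.exists_lt_of_sum_lt (s := Finset.univ) (f := fun _ => (0 : ℝ))
    (by simpa using h)
  refine ⟨l, lt_of_le_of_ne (hA _ _) fun h0 => ?_, lt_of_le_of_ne (hB _ _) fun h0 => ?_⟩
  · simp [← h0] at hl
  · simp [← h0] at hl

namespace Primitives

variable {N : ℕ} {E : Primitives N} {price : ℕ → ℝ} {W : ℕ → Fin (N + 1) → ℝ}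

theorem mul_typeWealth_le (hP : ∀ t, 0 < price t) (hW : ∀ t n, 0 ≤ W t n)
    (hrec : ∀ t n', W (t + 1) n' = ∑ n, E.trans n n' * (E.β * E.bestReturn price t n) * W t n)
    (t : ℕ) (n n' : Fin (N + 1)) :
    E.trans n n' * (E.β * E.bestReturn price t n) * W t n ≤ W (t + 1) n' := by
  rw [hrec]
  exact Finset.single_le_sum
    (f := fun n => E.trans n n' * (E.β * E.bestReturn price t n) * W t n)
    (fun n _ => mul_nonneg (mul_nonneg (E.trans_nonneg _ _)
      (mul_nonneg E.β_pos.le (E.bestReturn_pos hP t n).le)) (hW t n)) (Finset.mem_univ n)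

/-- Returns are positive, so wealth flows along every positive transition. -/
theorem typeWealth_pos_of_pow_pos (hP : ∀ t, 0 < price t) (hW : ∀ t n, 0 ≤ W t n)
    (hrec : ∀ t n', W (t + 1) n' = ∑ n, E.trans n n' * (E.β * E.bestReturn price t n) * W t n)
    {t k : ℕ} {n m : Fin (N + 1)} (h : 0 < W t n) (hk : 0 < (E.trans ^ k) n m) :
    0 < W (t + k) m := by
  induction k generalizing m with
  | zero =>
    rw [pow_zero, Matrix.one_apply] at hk
    split_ifs at hk with hnm
    · exact hnm ▸ h
    · exact absurd hk (lt_irrefl _)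
  | succ k ih =>
    rw [pow_succ] at hk
    obtain ⟨l, h1, h2⟩ :=
      exists_pos_of_mul_apply_pos (Matrix.pow_apply_nonneg E.trans_nonneg k) E.trans_nonneg hk
    exact lt_of_lt_of_le
      (mul_pos (mul_pos h2 (mul_pos E.β_pos (E.bestReturn_pos hP (t + k) l))) (ih h1))
      (mul_typeWealth_le hP hW hrec (t + k) l m)

/-- The asset price is at least a fixed fraction of the wealth of each type. -/
theorem exists_mul_typeWealth_le_price (htrans : E.trans.IsIrreducible) (hP : ∀ t, 0 < price t)
    (hW : ∀ t n, 0 ≤ W t n)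
    (hrec : ∀ t n', W (t + 1) n' = ∑ n, E.trans n n' * (E.β * E.bestReturn price t n) * W t n)
    (hdemand : ∀ t n, E.z n < E.assetReturn price t → E.β * W t n ≤ price t)
    (n : Fin (N + 1)) : ∃ κ, 0 < κ ∧ ∀ t, κ * W t n ≤ price t := by
  -- Induction on the length `k` of a path from `n` to the saver type `0`.
  obtain ⟨k, -, hk⟩ := (Matrix.isIrreducible_iff_exists_pow_pos E.trans_nonneg).1 htrans n 0
  have hzero : ∀ t, E.β * W t 0 ≤ price t := fun t =>
    hdemand t 0 (by rw [E.z_zero]; exact E.assetReturn_pos hP t)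
  induction k generalizing n with
  | zero =>
    rw [pow_zero, Matrix.one_apply] at hk
    split_ifs at hk with hnm
    · exact ⟨E.β, E.β_pos, by rw [hnm]; exact hzero⟩
    · exact absurd hk (lt_irrefl _)
  | succ k ih =>
    by_cases hn : n = 0
    · exact ⟨E.β, E.β_pos, by rw [hn]; exact hzero⟩
    rw [pow_succ'] at hk
    obtain ⟨l, h1, h2⟩ :=
      exists_pos_of_mul_apply_pos E.trans_nonneg (Matrix.pow_apply_nonneg E.trans_nonneg k) hk
    obtain ⟨κ, hκ, hκle⟩ := ih l h2
    have hz := E.z_pos hn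
    have hlast := hz.trans_le (E.z_le_last n)
    refine ⟨min E.β (κ * (E.trans n l * (E.β * E.z n)) / E.z (Fin.last N)),
      lt_min E.β_pos (div_pos (mul_pos hκ (mul_pos h1 (mul_pos E.β_pos hz))) hlast), fun t => ?_⟩
    -- Either the asset beats all capital and type `n` saves in it, or its return is at most `z_N`
    -- and the bound for `l` at `t + 1` is pulled back to `t`.
    rcases lt_or_ge (E.z (Fin.last N)) (E.assetReturn price t) with h | h
    · exact (mul_le_mul_of_nonneg_right (min_le_left _ _) (hW t n)).trans
        (hdemand t n ((E.z_le_last n).trans_lt h))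
    · refine (mul_le_mul_of_nonneg_right (min_le_right _ _) (hW t n)).trans ?_
      rw [div_mul_eq_mul_div, div_le_iff₀ hlast]
      have h3 : E.trans n l * (E.β * E.z n) * W t n ≤ W (t + 1) l := by
        refine le_trans ?_ (mul_typeWealth_le hP hW hrec t n l)
        refine mul_le_mul_of_nonneg_right (mul_le_mul_of_nonneg_left
          (mul_le_mul_of_nonneg_left (le_max_left _ _) E.β_pos.le) h1.le) (hW t n)
      calc κ * (E.trans n l * (E.β * E.z n)) * W t n
          = κ * (E.trans n l * (E.β * E.z n) * W t n) := by ring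
        _ ≤ κ * W (t + 1) l := mul_le_mul_of_nonneg_left h3 hκ.le
        _ ≤ price (t + 1) := hκle (t + 1)
        _ ≤ price (t + 1) + E.D (t + 1) := le_add_of_nonneg_right (E.D_nonneg _)
        _ = E.assetReturn price t * price t := (E.assetReturn_mul hP t).symm
        _ ≤ price t * E.z (Fin.last N) := by
          rw [mul_comm]
          exact mul_le_mul_of_nonneg_left h (hP t).le

/-- Asset prices grow at least at the rate `ρ(A)`. -/
theorem exists_mul_growthRate_pow_le_price (htrans : E.trans.IsIrreducible)
    (hG : 0 < E.growthRate) (hP : ∀ t, 0 < price t) (hW : ∀ t n, 0 ≤ W t n)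
    (hrec : ∀ t n', W (t + 1) n' = ∑ n, E.trans n n' * (E.β * E.bestReturn price t n) * W t n)
    (hdemand : ∀ t n, E.z n < E.assetReturn price t → E.β * W t n ≤ price t)
    (hinit : ∃ n, 0 < W 0 n) :
    ∃ κ, 0 < κ ∧ ∀ᶠ t in atTop, κ * E.growthRate.toReal ^ t ≤ price t := by
  obtain ⟨htop, v, hv0, ⟨m, hm⟩, hv⟩ := exists_subinvariant_of_nonneg E.growthMatrix
    (fun n n' => mul_nonneg (mul_nonneg E.β_pos.le (E.z_nonneg n)) (E.trans_nonneg n n')) hG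
  change ∀ i, E.growthRate.toReal * v i ≤ _ at hv
  set G := E.growthRate.toReal with hGdef
  have hGpos : 0 < G := ENNReal.toReal_pos hG.ne' htop
  set S : ℕ → ℝ := fun t => ∑ n, W t n * v n with hS
  have hstep : ∀ t, G * S t ≤ S (t + 1) := fun t => by
    have h1 : S (t + 1) =
        ∑ n, W t n * ∑ n', E.trans n n' * (E.β * E.bestReturn price t n) * v n' := by
      simp only [hS, hrec, Finset.sum_mul, Finset.mul_sum]
      rw [Finset.sum_comm]
      exact Finset.sum_congr rfl fun n _ => Finset.sum_congr rfl fun n' _ => by ring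
    rw [h1]
    simp only [hS, Finset.mul_sum]
    refine Finset.sum_le_sum fun n _ => ?_
    rw [← Finset.mul_sum]
    calc G * (W t n * v n) = W t n * (G * v n) := by ring
      _ ≤ W t n * ∑ n', E.growthMatrix n n' * v n' := mul_le_mul_of_nonneg_left (hv n) (hW t n)
      _ ≤ W t n * ∑ n', E.trans n n' * (E.β * E.bestReturn price t n) * v n' := by
        refine mul_le_mul_of_nonneg_left (Finset.sum_le_sum fun n' _ => ?_) (hW t n)
        refine mul_le_mul_of_nonneg_right ?_ (hv0 n')
        rw [growthMatrix, Matrix.of_apply, mul_comm]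
        exact mul_le_mul_of_nonneg_left
          (mul_le_mul_of_nonneg_left (le_max_left _ _) E.β_pos.le) (E.trans_nonneg _ _)
  obtain ⟨n₀, hn₀⟩ := hinit
  -- `v` vanishes at type `0`, whose row in `A` is zero, and initial wealth may miss the support of
  -- `v`; irreducibility brings wealth to `m` by date `T`.
  obtain ⟨T, -, hT⟩ := (Matrix.isIrreducible_iff_exists_pow_pos E.trans_nonneg).1 htrans n₀ m
  have hWT := typeWealth_pos_of_pow_pos hP hW hrec hn₀ hT
  rw [zero_add] at hWT
  have hST : 0 < S T := lt_of_lt_of_le (mul_pos hWT hm)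
    (Finset.single_le_sum (f := fun n => W T n * v n)
      (fun n _ => mul_nonneg (hW T n) (hv0 n)) (Finset.mem_univ m))
  have hgrow : ∀ s, G ^ s * S T ≤ S (T + s) := fun s => by
    induction s with
    | zero => simp
    | succ s ih =>
      calc G ^ (s + 1) * S T = G * (G ^ s * S T) := by ring
        _ ≤ G * S (T + s) := mul_le_mul_of_nonneg_left ih hGpos.le
        _ ≤ S (T + (s + 1)) := hstep _
  choose κ hκ hκle using exists_mul_typeWealth_le_price htrans hP hW hrec hdemand
  have hSle : ∀ t, S t ≤ price t * ∑ n, v n / κ n := fun t => by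
    rw [Finset.mul_sum]
    refine Finset.sum_le_sum fun n _ => ?_
    have h1 : W t n ≤ price t / κ n := by
      rw [le_div_iff₀ (hκ n), mul_comm]; exact hκle n t
    calc W t n * v n ≤ price t / κ n * v n := mul_le_mul_of_nonneg_right h1 (hv0 n)
      _ = price t * (v n / κ n) := by ring
  have hC : 0 < ∑ n, v n / κ n := lt_of_lt_of_le (div_pos hm (hκ m))
    (Finset.single_le_sum (f := fun n => v n / κ n)
      (fun n _ => div_nonneg (hv0 n) (hκ n).le) (Finset.mem_univ m))
  refine ⟨S T / G ^ T / ∑ n, v n / κ n, by positivity, ?_⟩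
  filter_upwards [eventually_ge_atTop T] with t ht
  obtain ⟨s, rfl⟩ := Nat.exists_eq_add_of_le ht
  rw [div_mul_eq_mul_div, div_le_iff₀ hC]
  refine le_trans (le_trans (le_of_eq ?_) (hgrow s)) (hSle (T + s))
  rw [pow_add]
  field_simp

theorem isAsymptoticallyBubbly_of_growth {G κ : ℝ} (hG : 0 < G)
    (hlt : E.dividendGrowthRate < ENNReal.ofReal G) (hP : ∀ t, 0 < price t) (hκ : 0 < κ)
    (hgrow : ∀ᶠ t in atTop, κ * G ^ t ≤ price t) : IsAsymptoticallyBubbly price E.D G := by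
  refine ⟨isBubbly_of_summable hP E.D_nonneg ?_, ?_⟩
  · obtain ⟨g, M, hg0, hgG, hM, hD⟩ := E.exists_dividend_le hlt
    have hgeo : Summable fun t : ℕ => M / κ * (g / G) ^ t :=
      (summable_geometric_of_lt_one (div_pos hg0 hG).le ((div_lt_one hG).2 hgG)).mul_left _
    refine hgeo.of_norm_bounded_eventually_nat ?_
    filter_upwards [hgrow] with t ht
    rw [Real.norm_of_nonneg (div_nonneg (E.D_nonneg t) (hP t).le), div_pow, div_mul_div_comm]
    exact div_le_div₀ (by positivity) (hD t) (by positivity) ht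
  · refine lt_of_lt_of_le (EReal.coe_pos.2 hκ) (le_liminf_of_le (by isBoundedDefault) ?_)
    filter_upwards [hgrow] with t ht
    rw [EReal.coe_le_coe_iff, le_div_iff₀ (by positivity)]
    exact ht

end Primitives

/-! ### Finiteness of the positive part of utility. -/

/-- Turns a bound of order `h ^ t` on expected consumption into one linear in `t` on the expected
gain, which is summable against `β ^ t`. -/
theorem logGain_le {x h : ℝ} (hh : 1 ≤ h) (t : ℕ) :
    logGain x ≤ ENNReal.ofReal (t * Real.log h) + ENNReal.ofReal (x / h ^ t) := by
  rcases le_or_gt x 0 with hx | hx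
  · simp [logGain_of_nonpos hx]
  have hpow : 0 < h ^ t := pow_pos (by linarith) t
  rw [logGain_of_pos hx, ← ENNReal.ofReal_add
    (mul_nonneg (Nat.cast_nonneg _) (Real.log_nonneg hh)) (div_pos hx hpow).le]
  refine ENNReal.ofReal_le_ofReal ?_
  have h1 := Real.log_le_sub_one_of_pos (div_pos hx hpow)
  rw [Real.log_div hx.ne' hpow.ne', Real.log_pow] at h1
  linarith

theorem tsum_ofReal_pow_mul_ne_top {β a b : ℝ} (hβ : 0 < β) (hβ1 : β < 1) (ha : 0 ≤ a)
    (hb : 0 ≤ b) :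
    ∑' t : ℕ, ENNReal.ofReal (β ^ t) * (ENNReal.ofReal (t * a) + ENNReal.ofReal b) ≠ ⊤ := by
  have hs : Summable fun t : ℕ => (t : ℝ) ^ 1 * β ^ t * a + β ^ t * b :=
    ((summable_pow_mul_geometric_of_norm_lt_one 1
      (by rwa [Real.norm_of_nonneg hβ.le])).mul_right a).add
      ((summable_geometric_of_lt_one hβ.le hβ1).mul_right b)
  have heq : ∀ t : ℕ, ENNReal.ofReal (β ^ t) * (ENNReal.ofReal (t * a) + ENNReal.ofReal b) =
      ENNReal.ofReal ((t : ℝ) ^ 1 * β ^ t * a + β ^ t * b) := fun t => by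
    rw [← ENNReal.ofReal_add (by positivity) hb, ← ENNReal.ofReal_mul (by positivity)]
    congr 1
    ring
  simp only [heq]
  exact hs.tsum_ofReal_ne_top

theorem expectedSum_logGain_ne_top {Ω : Type*} {mΩ : MeasurableSpace Ω} {μ : Measure Ω}
    [IsProbabilityMeasure μ] {β h M : ℝ} (hβ : 0 < β) (hβ1 : β < 1) (hh : 1 ≤ h) (hM : 0 ≤ M)
    {c : ℕ → Ω → ℝ} (hcm : ∀ t, Measurable (c t)) (hc0 : ∀ t, ∀ᵐ ω ∂μ, 0 ≤ c t ω)
    (hci : ∀ t, Integrable (c t) μ) (hcM : ∀ t, ∫ ω, c t ω ∂μ ≤ M * h ^ t) :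
    expectedSum μ β (fun t ω => logGain (c t ω)) ≠ ⊤ := by
  refine ne_top_of_le_ne_top (tsum_ofReal_pow_mul_ne_top hβ hβ1 (Real.log_nonneg hh) hM) ?_
  have hm : ∀ t, Measurable fun ω => logGain (c t ω) := fun t => measurable_logGain.comp (hcm t)
  rw [expectedSum, lintegral_tsum fun t => ((hm t).const_mul _).aemeasurable]
  refine ENNReal.tsum_le_tsum fun t => ?_
  rw [lintegral_const_mul _ (hm t)]
  gcongr
  refine (lintegral_mono fun ω => logGain_le hh t).trans ?_
  have hpow : 0 < h ^ t := pow_pos (by linarith) t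
  rw [lintegral_add_left measurable_const, lintegral_const, measure_univ, mul_one,
    ← ofReal_integral_eq_lintegral_ofReal ((hci t).div_const _)
      ((hc0 t).mono fun ω hω => div_nonneg hω hpow.le), integral_div]
  gcongr
  rw [div_le_iff₀ hpow]
  exact hcM t

/-! ### Aggregation over agents in equilibrium. -/

namespace Population

variable {N : ℕ} {E : Primitives N} {I Ω : Type*} [MeasurableSpace I] [mΩ : MeasurableSpace Ω]
  {lam : Measure I} {Pr : Measure Ω} {pop : Population E lam Pr} {price : ℕ → ℝ}
  {c k x : ℕ → I → Ω → ℝ}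

theorem measurable_type_comp (t : ℕ) (f : Fin (N + 1) → ℝ) :
    Measurable[pop.ext.sig] fun p : I × Ω => f (pop.type t p.1 p.2) :=
  (Measurable.of_discrete (f := f)).comp (pop.type_measurable t)

theorem integrable_initialWealth : Integrable (pop.initialWealth price) lam := by
  obtain ⟨B, hB⟩ : ∃ B, ∀ n, ‖E.z n‖ ≤ B :=
    ⟨E.z (Fin.last N), fun n => by
      rw [Real.norm_of_nonneg (E.z_nonneg n)]; exact E.z_le_last n⟩
  have hz : Measurable fun i => E.z (pop.prevType i) :=
    (Measurable.of_discrete (f := E.z)).comp pop.prevType_measurable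
  exact (pop.k₀_integrable.bdd_mul hz.aestronglyMeasurable
    (ae_of_all _ fun i => hB _)).add (pop.x₀_integrable.const_mul _)

theorem integrable_output (t : ℕ) {f : I × Ω → ℝ} (hf : Integrable f pop.ext.meas) :
    Integrable (fun p : I × Ω => E.z (pop.type t p.1 p.2) * f p) pop.ext.meas :=
  hf.bdd_mul (measurable_type_comp t E.z).aestronglyMeasurable (ae_of_all _ fun p => by
    rw [Real.norm_of_nonneg (E.z_nonneg _)]; exact E.z_le_last _)

namespace IsEquilibrium

theorem aemeasurable_wealth [IsProbabilityMeasure lam] [IsProbabilityMeasure Pr]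
    (h : pop.IsEquilibrium price c k x) (t : ℕ) :
    AEMeasurable (fun p : I × Ω =>
      pop.wealth price p.1 (fun t => k t p.1) (fun t => x t p.1) t p.2) pop.ext.meas := by
  cases t with
  | zero =>
    exact (pop.ext.measurePreserving_fst.integrable_comp_of_integrable
      integrable_initialWealth).aestronglyMeasurable.aemeasurable
  | succ t =>
    exact (((measurable_type_comp t E.z).mul (h.k_measurable t)).add
      ((h.x_measurable t).const_mul _)).aemeasurable

theorem ae_nonneg [IsProbabilityMeasure lam] [IsProbabilityMeasure Pr]
    (h : pop.IsEquilibrium price c k x) (t : ℕ) :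
    ∀ᵐ p ∂pop.ext.meas, 0 ≤ c t p.1 p.2 ∧ 0 ≤ k t p.1 p.2 ∧ 0 ≤ x t p.1 p.2 := by
  refine (pop.ext.ae_of_ae_ae_right (measurableSet_le measurable_const
    (h.c_measurable t)).nullMeasurableSet ?_).and ((pop.ext.ae_of_ae_ae_right
    (measurableSet_le measurable_const (h.k_measurable t)).nullMeasurableSet ?_).and
    (pop.ext.ae_of_ae_ae_right (measurableSet_le measurable_const
    (h.x_measurable t)).nullMeasurableSet ?_))
  · exact h.optimal.mono fun i hi => hi.feasible.c_nonneg t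
  · exact h.optimal.mono fun i hi => hi.feasible.k_nonneg t
  · exact h.optimal.mono fun i hi => hi.feasible.x_nonneg t

theorem ae_budget [IsProbabilityMeasure lam] [IsProbabilityMeasure Pr]
    (h : pop.IsEquilibrium price c k x) (t : ℕ) :
    ∀ᵐ p ∂pop.ext.meas, c t p.1 p.2 + k t p.1 p.2 + price t * x t p.1 p.2 =
      pop.wealth price p.1 (fun t => k t p.1) (fun t => x t p.1) t p.2 := by
  refine pop.ext.ae_of_ae_ae_right (nullMeasurableSet_eq_fun
    (((h.c_measurable t).add (h.k_measurable t)).add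
      ((h.x_measurable t).const_mul _)).aemeasurable (h.aemeasurable_wealth t)) ?_
  exact h.optimal.mono fun i hi => hi.feasible.budget t

theorem integrable_x [IsProbabilityMeasure lam] [IsProbabilityMeasure Pr]
    (h : pop.IsEquilibrium price c k x) (t : ℕ) :
    Integrable (fun p : I × Ω => x t p.1 p.2) pop.ext.meas :=
  pop.ext.integrable_of_integral_left_eq_one (h.x_measurable t)
    ((h.ae_nonneg t).mono fun _ hp => hp.2.2) (h.clearing t)

theorem integral_x [IsProbabilityMeasure lam] [IsProbabilityMeasure Pr]
    (h : pop.IsEquilibrium price c k x) (t : ℕ) :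
    ∫ p, x t p.1 p.2 ∂pop.ext.meas = 1 := by
  rw [pop.ext.integral_eq_left _ (h.integrable_x t), integral_congr_ae (h.clearing t)]
  simp

theorem integrable_of_wealth [IsProbabilityMeasure lam] [IsProbabilityMeasure Pr]
    (h : pop.IsEquilibrium price c k x) (t : ℕ)
    (hw : Integrable (fun p : I × Ω =>
      pop.wealth price p.1 (fun t => k t p.1) (fun t => x t p.1) t p.2) pop.ext.meas) :
    Integrable (fun p : I × Ω => c t p.1 p.2) pop.ext.meas ∧
      Integrable (fun p : I × Ω => k t p.1 p.2) pop.ext.meas := by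
  constructor
  · refine hw.mono' (h.c_measurable t).aestronglyMeasurable ?_
    filter_upwards [h.ae_nonneg t, h.ae_budget t] with p hp hb
    rw [Real.norm_of_nonneg hp.1]
    have := mul_nonneg (h.price_nonneg t) hp.2.2
    linarith
  · refine hw.mono' (h.k_measurable t).aestronglyMeasurable ?_
    filter_upwards [h.ae_nonneg t, h.ae_budget t] with p hp hb
    rw [Real.norm_of_nonneg hp.2.1]
    have := mul_nonneg (h.price_nonneg t) hp.2.2
    linarith

/-- Initial endowments are integrable; from then on the budget bounds capital by wealth, and market
clearing makes asset holdings integrable. -/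
theorem integrable_wealth [IsProbabilityMeasure lam] [IsProbabilityMeasure Pr]
    (h : pop.IsEquilibrium price c k x) (t : ℕ) :
    Integrable (fun p : I × Ω =>
      pop.wealth price p.1 (fun t => k t p.1) (fun t => x t p.1) t p.2) pop.ext.meas := by
  induction t with
  | zero =>
    exact pop.ext.measurePreserving_fst.integrable_comp_of_integrable integrable_initialWealth
  | succ t ih =>
    exact (integrable_output t (h.integrable_of_wealth t ih).2).add
      ((h.integrable_x t).const_mul _)

/-- Consumption and capital do not use up more than output and dividends. -/
theorem integral_consumption_succ_le [IsProbabilityMeasure lam] [IsProbabilityMeasure Pr]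
    (h : pop.IsEquilibrium price c k x) (t : ℕ) :
    ∫ p, c (t + 1) p.1 p.2 ∂pop.ext.meas + ∫ p, k (t + 1) p.1 p.2 ∂pop.ext.meas ≤
      E.z (Fin.last N) * ∫ p, k t p.1 p.2 ∂pop.ext.meas + E.D (t + 1) := by
  obtain ⟨hc, hk⟩ := h.integrable_of_wealth (t + 1) (h.integrable_wealth (t + 1))
  have hk0 := (h.integrable_of_wealth t (h.integrable_wealth t)).2
  have hck : Integrable (fun p : I × Ω => c (t + 1) p.1 p.2 + k (t + 1) p.1 p.2) pop.ext.meas :=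
    hc.add hk
  have h1 := integral_congr_ae (h.ae_budget (t + 1))
  simp only [wealth] at h1
  rw [integral_add hck ((h.integrable_x (t + 1)).const_mul _), integral_add hc hk,
    integral_add (integrable_output t hk0) ((h.integrable_x t).const_mul _),
    integral_const_mul, integral_const_mul, h.integral_x, h.integral_x] at h1
  have h2 : ∫ p : I × Ω, E.z (pop.type t p.1 p.2) * k t p.1 p.2 ∂pop.ext.meas ≤
      ∫ p : I × Ω, E.z (Fin.last N) * k t p.1 p.2 ∂pop.ext.meas := by
    refine integral_mono_ae (integrable_output t hk0) (hk0.const_mul _) ?_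
    filter_upwards [h.ae_nonneg t] with p hp
    exact mul_le_mul_of_nonneg_right (E.z_le_last _) hp.2.1
  rw [integral_const_mul] at h2
  linarith

theorem exists_integral_consumption_le [IsProbabilityMeasure lam] [IsProbabilityMeasure Pr]
    (h : pop.IsEquilibrium price c k x) {g M : ℝ} (hg : 0 < g) (hM : 0 < M)
    (hD : ∀ t, E.D t ≤ M * g ^ t) :
    ∃ h' M' : ℝ, 1 ≤ h' ∧ 0 ≤ M' ∧ ∀ t, ∫ p, c t p.1 p.2 ∂pop.ext.meas ≤ M' * h' ^ t := by
  set C : ℕ → ℝ := fun t => ∫ p, c t p.1 p.2 ∂pop.ext.meas with hC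
  set K : ℕ → ℝ := fun t => ∫ p, k t p.1 p.2 ∂pop.ext.meas with hK
  have hC0 : ∀ t, 0 ≤ C t := fun t =>
    integral_nonneg_of_ae ((h.ae_nonneg t).mono fun p hp => hp.1)
  have hK0 : ∀ t, 0 ≤ K t := fun t =>
    integral_nonneg_of_ae ((h.ae_nonneg t).mono fun p hp => hp.2.1)
  have hz := E.z_nonneg (Fin.last N)
  -- `h' ≥ 2 z_N` and `M' ≥ 2 M` keep output and dividends each below half of `M' * h' ^ (t + 1)`.
  set h' := 2 * E.z (Fin.last N) + g + 1 with hh'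
  set M' := 2 * M + C 0 + K 0 with hM'
  have h1 : 1 ≤ h' := by linarith
  have hM'0 : 0 ≤ M' := by linarith [hC0 0, hK0 0]
  refine ⟨h', M', h1, hM'0, ?_⟩
  have hsum : ∀ t, C t + K t ≤ M' * h' ^ t := fun t => by
    induction t with
    | zero => simp only [pow_zero, mul_one]; linarith
    | succ t ih =>
      have hpow : 0 < h' ^ t := pow_pos (by linarith) t
      have h2 : E.D (t + 1) ≤ M * h' ^ (t + 1) := (hD _).trans (by gcongr; linarith)
      have h3 : E.z (Fin.last N) * K t ≤ E.z (Fin.last N) * (M' * h' ^ t) :=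
        mul_le_mul_of_nonneg_left (by linarith [hC0 t]) hz
      have h4 := h.integral_consumption_succ_le t
      have h5 : 2 * (E.z (Fin.last N) * (M' * h' ^ t)) ≤ M' * h' ^ (t + 1) := by
        rw [pow_succ]
        have : 0 ≤ M' * h' ^ t := by positivity
        nlinarith
      have h6 : 2 * (M * h' ^ (t + 1)) ≤ M' * h' ^ (t + 1) := by
        rw [← mul_assoc]
        gcongr
        linarith [hC0 0, hK0 0]
      linarith
  exact fun t => by linarith [hsum t, hK0 t]

/-- Resource constraints bound the growth of consumption, hence the utility of almost all agents. -/
theorem ae_expectedSum_logGain_ne_top [IsProbabilityMeasure lam] [IsProbabilityMeasure Pr]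
    (h : pop.IsEquilibrium price c k x) {g M : ℝ} (hg : 0 < g) (hM : 0 < M)
    (hD : ∀ t, E.D t ≤ M * g ^ t) :
    ∀ᵐ i ∂lam, expectedSum Pr E.β (fun t ω => logGain (c t i ω)) ≠ ⊤ := by
  obtain ⟨h', M', hh', hM', hle⟩ := h.exists_integral_consumption_le hg hM hD
  have := pop.ext.prob
  have h1 := expectedSum_logGain_ne_top (c := fun t (p : I × Ω) => c t p.1 p.2) E.β_pos E.β_lt_one
    hh' hM' h.c_measurable (fun t => (h.ae_nonneg t).mono fun p hp => hp.1)
    (fun t => (h.integrable_of_wealth t (h.integrable_wealth t)).1) hle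
  exact pop.ext.ae_lintegral_right_ne_top
    (measurable_discountedSum fun t => measurable_logGain.comp (h.c_measurable t)) h1

/-- A zero price forces a zero payoff, hence a zero price and dividend at the next date, and so on
forever. -/
theorem price_pos [IsProbabilityMeasure lam] [IsProbabilityMeasure Pr]
    (h : pop.IsEquilibrium price c k x)
    (hgain : ∀ᵐ i ∂lam, expectedSum Pr E.β (fun t ω => logGain (c t i ω)) ≠ ⊤)
    (hD : ∃ᶠ t in atTop, 0 < E.D t) (t : ℕ) : 0 < price t := by
  refine lt_of_le_of_ne (h.price_nonneg t) fun h0 => ?_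
  obtain ⟨i, hi, hgi⟩ := (h.optimal.and hgain).exists
  have hz : ∀ s, price (t + s) = 0 := fun s => by
    induction s with
    | zero => exact h0.symm
    | succ s ih =>
      have := hi.payoff_eq_zero h.price_nonneg hgi ih
      change price (t + s + 1) = 0
      linarith [h.price_nonneg (t + s + 1), E.D_nonneg (t + s + 1)]
  obtain ⟨s, hs, hDs⟩ := frequently_atTop.1 hD (t + 1)
  obtain ⟨r, rfl⟩ := Nat.exists_eq_add_of_le hs
  have h1 := hi.payoff_eq_zero h.price_nonneg hgi (hz r)
  have h2 := h.price_nonneg (t + r + 1)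
  rw [add_right_comm] at hDs
  linarith

end IsEquilibrium

/-! ### Wealth by type in equilibrium. -/

/-- Aggregate wealth of the agents of type `n`. -/
noncomputable def typeWealth (pop : Population E lam Pr) (price : ℕ → ℝ) (k x : ℕ → I → Ω → ℝ)
    (t : ℕ) (n : Fin (N + 1)) : ℝ :=
  ∫ p, (if pop.type t p.1 p.2 = n then
    pop.wealth price p.1 (fun t => k t p.1) (fun t => x t p.1) t p.2 else 0) ∂pop.ext.meas

namespace IsEquilibrium

variable [IsProbabilityMeasure lam] [IsProbabilityMeasure Pr]

theorem ae_wealth_nonneg (h : pop.IsEquilibrium price c k x) (t : ℕ) :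
    ∀ᵐ p ∂pop.ext.meas,
      0 ≤ pop.wealth price p.1 (fun t => k t p.1) (fun t => x t p.1) t p.2 := by
  filter_upwards [h.ae_nonneg t, h.ae_budget t] with p hp hb
  have := mul_nonneg (h.price_nonneg t) hp.2.2
  linarith

theorem typeWealth_nonneg (h : pop.IsEquilibrium price c k x) (t : ℕ) (n : Fin (N + 1)) :
    0 ≤ pop.typeWealth price k x t n := by
  refine integral_nonneg_of_ae ?_
  filter_upwards [h.ae_wealth_nonneg t] with p hp
  simp only [Pi.zero_apply]
  split_ifs
  exacts [hp, le_rfl]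

theorem integrable_typeWealth (h : pop.IsEquilibrium price c k x) (t : ℕ) (n : Fin (N + 1)) :
    Integrable (fun p : I × Ω => if pop.type t p.1 p.2 = n then
      pop.wealth price p.1 (fun t => k t p.1) (fun t => x t p.1) t p.2 else 0) pop.ext.meas := by
  have heq : (fun p : I × Ω => if pop.type t p.1 p.2 = n then
      pop.wealth price p.1 (fun t => k t p.1) (fun t => x t p.1) t p.2 else 0) =
      {p : I × Ω | pop.type t p.1 p.2 = n}.indicator fun p =>
        pop.wealth price p.1 (fun t => k t p.1) (fun t => x t p.1) t p.2 := by
    ext p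
    simp [Set.indicator_apply]
  rw [heq]
  exact (h.integrable_wealth t).indicator (pop.type_measurable t (measurableSet_singleton n))

/-- `typeWealth` averages over agents and states jointly, so the recursion for each agent's expected
wealth only has to be integrated over agents. -/
theorem typeWealth_succ (h : pop.IsEquilibrium price c k x) (hP : ∀ t, 0 < price t)
    (hgain : ∀ᵐ i ∂lam, expectedSum Pr E.β (fun t ω => logGain (c t i ω)) ≠ ⊤)
    (t : ℕ) (n' : Fin (N + 1)) :
    pop.typeWealth price k x (t + 1) n' =
      ∑ n, E.trans n n' * (E.β * E.bestReturn price t n) * pop.typeWealth price k x t n := by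
  have htarget : ∀ᵐ i ∂lam, ∀ t n,
      ∫ ω, (if pop.type t i ω = n then
        pop.wealth price i (fun t => k t i) (fun t => x t i) t ω else 0) ∂Pr =
      ∫ ω, (if pop.type t i ω = n then pop.targetWealth price i t ω else 0) ∂Pr := by
    filter_upwards [h.optimal, hgain] with i hi hgi t n
    refine integral_congr_ae ?_
    filter_upwards [hi.wealth_eq hP hgi] with ω hω
    rw [(hω t).1]
  simp only [typeWealth]
  rw [pop.ext.integral_eq_right _ (h.integrable_typeWealth (t + 1) n')]
  have hterm : ∀ n, E.trans n n' * (E.β * E.bestReturn price t n) *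
      ∫ p, (if pop.type t p.1 p.2 = n then
        pop.wealth price p.1 (fun t => k t p.1) (fun t => x t p.1) t p.2 else 0) ∂pop.ext.meas =
      ∫ i, E.trans n n' * (E.β * E.bestReturn price t n) * ∫ ω, (if pop.type t i ω = n then
        pop.wealth price i (fun t => k t i) (fun t => x t i) t ω else 0) ∂Pr ∂lam := fun n => by
    rw [pop.ext.integral_eq_right _ (h.integrable_typeWealth t n), integral_const_mul]
  rw [Finset.sum_congr rfl fun n _ => hterm n, ← integral_finsetSum _ fun n _ =>
    (pop.ext.integrable_integral_right _ (h.integrable_typeWealth t n)).const_mul _]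
  refine integral_congr_ae ?_
  filter_upwards [htarget] with i hi
  simp only [hi]
  exact pop.integral_targetWealth_succ t n'

/-- Agents of type `n` then hold no capital, so their savings, `β` times wealth, are part of the
market value of the unit supply. -/
theorem mul_typeWealth_le_price (h : pop.IsEquilibrium price c k x) (hP : ∀ t, 0 < price t)
    (hgain : ∀ᵐ i ∂lam, expectedSum Pr E.β (fun t ω => logGain (c t i ω)) ≠ ⊤)
    (t : ℕ) (n : Fin (N + 1)) (hn : E.z n < E.assetReturn price t) :
    E.β * pop.typeWealth price k x t n ≤ price t := by
  have hle : ∀ᵐ p ∂pop.ext.meas, E.β * (if pop.type t p.1 p.2 = n then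
      pop.wealth price p.1 (fun t => k t p.1) (fun t => x t p.1) t p.2 else 0) ≤
      price t * x t p.1 p.2 := by
    refine pop.ext.ae_of_ae_ae_right (nullMeasurableSet_le
      ((h.integrable_typeWealth t n).aestronglyMeasurable.aemeasurable.const_mul _)
      ((h.x_measurable t).const_mul _).aemeasurable) ?_
    filter_upwards [h.optimal, hgain] with i hi hgi
    filter_upwards [hi.wealth_eq hP hgi, hi.feasible.x_nonneg t] with ω hω hx
    obtain ⟨h1, h2, h3⟩ := hω t
    split_ifs with htype
    · rw [h1, ← h2, h3 (by rw [htype]; exact hn), zero_add]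
    · rw [mul_zero]; exact mul_nonneg (hP t).le hx
  have h1 := integral_mono_ae ((h.integrable_typeWealth t n).const_mul _)
    ((h.integrable_x t).const_mul _) hle
  rwa [integral_const_mul, integral_const_mul, h.integral_x, mul_one] at h1

/-- Utility above `-∞` requires positive initial wealth for almost every agent. -/
theorem exists_typeWealth_zero_pos (h : pop.IsEquilibrium price c k x) :
    ∃ n, 0 < pop.typeWealth price k x 0 n := by
  by_contra! hle
  have h1 : ∑ n, pop.typeWealth price k x 0 n = 0 :=
    Finset.sum_eq_zero fun n _ => le_antisymm (hle n) (h.typeWealth_nonneg 0 n)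
  simp only [typeWealth] at h1
  rw [← integral_finsetSum _ fun n _ => h.integrable_typeWealth 0 n] at h1
  simp only [Finset.sum_ite_eq, Finset.mem_univ, if_true] at h1
  rw [integral_eq_zero_iff_of_nonneg_ae (h.ae_wealth_nonneg 0) (h.integrable_wealth 0)] at h1
  obtain ⟨i, hi, hi'⟩ := (h.optimal.and (pop.ext.ae_ae_right h1)).exists
  obtain ⟨ω, hω⟩ := hi'.exists
  exact (hi.initialWealth_pos h.price_nonneg).ne' hω

end IsEquilibrium

end Population

end Bewley

theorem theorem4 {N : ℕ} (E : Bewley.Primitives N)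
    {I Ω : Type*} [MeasurableSpace I] [MeasurableSpace Ω]
    (lam : Measure I) [IsProbabilityMeasure lam] (Pr : Measure Ω) [IsProbabilityMeasure Pr]
    (pop : Bewley.Population E lam Pr)
    (htrans : E.trans.IsIrreducible)
    (hinvestor : E.investorTrans.IsIrreducible)
    (hpos : 0 < E.dividendGrowthRate)
    (hlt : E.dividendGrowthRate < E.growthRate)
    (price : ℕ → ℝ) (c k x : ℕ → I → Ω → ℝ)
    (hequil : pop.IsEquilibrium price c k x) :
    Bewley.IsAsymptoticallyBubbly price E.D E.growthRate.toReal := by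
  have hG : 0 < E.growthRate := hpos.trans hlt
  have htop : E.growthRate ≠ ⊤ := (Bewley.exists_subinvariant_of_nonneg E.growthMatrix
    (fun n n' => mul_nonneg (mul_nonneg E.β_pos.le (E.z_nonneg n)) (E.trans_nonneg n n')) hG).1
  have hlt' : E.dividendGrowthRate < ENNReal.ofReal E.growthRate.toReal := by
    rwa [ENNReal.ofReal_toReal htop]
  obtain ⟨g, M, hg, -, hM, hD⟩ := E.exists_dividend_le hlt'
  have hgain := hequil.ae_expectedSum_logGain_ne_top hg hM hD
  have hP := hequil.price_pos hgain (E.frequently_dividend_pos hpos)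
  obtain ⟨κ, hκ, hgrow⟩ := Bewley.Primitives.exists_mul_growthRate_pow_le_price htrans hG hP
    hequil.typeWealth_nonneg (hequil.typeWealth_succ hP hgain)
    (hequil.mul_typeWealth_le_price hP hgain) hequil.exists_typeWealth_zero_pos
  exact Bewley.Primitives.isAsymptoticallyBubbly_of_growth (ENNReal.toReal_pos hG.ne' htop) hlt' hP
    hκ hgrow
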